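/- Let $M$ be a connected smooth manifold (manifolds are finite-dimensional, Hausdorff, paracompact and smooth), let $G$ be a connected Lie group with identity $e$, and let $\rho:\tilde G\to G$ be its universal covering group, i.e. a simply connected Lie group $\tilde G$ with a homomorphism $\rho$ that is a smooth covering map. Let $\pi:P\to M$ be a smooth principal $G$-bundle (with right $G$-action), fix $p_0\in P$, put $m_0=\pi(p_0)$, and let $i:G\to P$, $i(g)=p_0g$. Write $\pi_1(P)=\pi_1(P,p_0)$, $\pi_1(M)=\pi_1(M,m_0)$, $\pi_1(G)=\pi_1(G,e)$, with induced homomorphisms $i_*:\pi_1(G)\to\pi_1(P)$ and $\pi_*:\pi_1(P)\to\pi_1(M)$. A spinor structure for $P$ is a smooth principal $\tilde G$-bundle $\pi_Q:Q\to M$ together with a smooth map $u:Q\to P$ such that $\pi\circ u=\pi_Q$ and $u(q\tilde g)=u(q)\rho(\tilde g)$ for all $q\in Q$, $\tilde g\in\tilde G$. Two spinor structures $u:Q\to P$ and $u':Q'\to P$ are equivalent if there is a morphism of principal $\tilde G$-bundles over $M$ (a smooth $\tilde G$-equivariant map over $\mathrm{id}_M$) $a:Q\to Q'$ with $u'\circ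 a=u$. Call a subgroup $K\le\pi_1(P)$ a complement if $\pi_1(P)$ is the internal direct product $K\times i_*(\pi_1(G))$ and $\pi_*$ restricts to an isomorphism $K\to\pi_1(M)$. Suppose that $i_*$ is injective and that a complement exists (the conditions of the Existence Theorem). Then: 1. Equivalence of spinor structures is an equivalence relation, and $[u:Q\to P]\mapsto u_*(\pi_1(Q,q_0))$, where $q_0$ is any point of $u^{-1}(p_0)$, is a well-defined bijection from the set of equivalence classes of spinor structures for $P$ onto the set of complements. 2. Fix a spinor structure $S_0$ for $P$ with corresponding complement $K_0$. Then there is a bijection from the set of equivalence classes of spinor structures for $P$ onto the set of group homomorphisms $\pi_1(M)\to\pi_1(G)$, which sends the class of $S_0$ to the trivial homomorphism, and such that a class which is sent to $\varphi$ corresponds under 1 to the complement $\{\,k\cdot i_*(\varphi(\pi_*(k))) : k\in K_0\,\}$. -/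

import Mathlib

open scoped Manifold ContDiff RightActions

universe uM uP uG uH

/-- `π : P → M` is a smooth (right) principal fibre bundle with structure group the Lie group `G`.
Here `m`, `k`, `n` are the dimensions of `M`, `G`, `P`, and `p <• g` is the right action of
`g : G` on `p : P`, i.e. `MulOpposite.op g • p`. -/
structure IsPrincipalBundle (m k n : ℕ) {M : Type uM} {P : Type uP} (G : Type uG)
    [TopologicalSpace M] [ChartedSpace (EuclideanSpace ℝ (Fin m)) M]
    [TopologicalSpace P] [ChartedSpace (EuclideanSpace ℝ (Fin n)) P]
    [TopologicalSpace G] [ChartedSpace (EuclideanSpace ℝ (Fin k)) G] [Group G]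
    [MulAction Gᵐᵒᵖ P] (π : P → M) : Prop where
  contMDiff_proj : ContMDiff (𝓡 n) (𝓡 m) ∞ π
  surjective_proj : Function.Surjective π
  contMDiff_action : ContMDiff ((𝓡 n).prod (𝓡 k)) (𝓡 n) ∞ (fun x : P × G => x.1 <• x.2)
  /-- The action preserves the fibres. -/
  proj_smul : ∀ (p : P) (g : G), π (p <• g) = π p
  /-- The action is transitive on fibres. -/
  transitive : ∀ p q : P, π p = π q → ∃ g : G, p <• g = q
  /-- The action is free. -/
  free : ∀ (p : P) (g : G), p <• g = p → g = 1
  /-- Near every point there is a smooth, `G`-equivariant local trivialisation. -/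
  locally_trivial : ∀ x : M, ∃ e : Bundle.Trivialization G π, x ∈ e.baseSet ∧
    ContMDiffOn (𝓡 n) ((𝓡 m).prod (𝓡 k)) ∞ e e.source ∧
    ContMDiffOn ((𝓡 m).prod (𝓡 k)) (𝓡 n) ∞ e.toOpenPartialHomeomorph.symm e.target ∧
    ∀ p ∈ e.source, ∀ g : G, (e (p <• g)).2 = (e p).2 * g

/-- `ρ : G' → G` exhibits the Lie group `G'` as a universal covering group of `G`: `G'` is simply
connected, and `ρ` is a homomorphism and a smooth covering map. -/
structure IsUniversalCoveringGroup (k : ℕ) {G : Type uG} {G' : Type uH}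
    [TopologicalSpace G] [ChartedSpace (EuclideanSpace ℝ (Fin k)) G] [Group G]
    [TopologicalSpace G'] [ChartedSpace (EuclideanSpace ℝ (Fin k)) G'] [Group G']
    (ρ : G' →* G) : Prop where
  simplyConnected : SimplyConnectedSpace G'
  isCoveringMap : IsCoveringMap ρ
  isLocalDiffeomorph : IsLocalDiffeomorph (𝓡 k) (𝓡 k) ∞ ρ

/-- A spinor structure for `π : P → M` relative to `ρ : G' → G`: a principal `G'`-bundle `Q` over
`M` together with a smooth bundle morphism `Q → P` over the identity of `M` that is equivariant
relative to `ρ`. (The dimension of `Q` is necessarily that of `P`.) -/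
structure SpinorStructure (m k n : ℕ) {M : Type uM} {P : Type uP} {G : Type uG} {G' : Type uH}
    [TopologicalSpace M] [ChartedSpace (EuclideanSpace ℝ (Fin m)) M]
    [TopologicalSpace P] [ChartedSpace (EuclideanSpace ℝ (Fin n)) P]
    [Group G] [MulAction Gᵐᵒᵖ P]
    [TopologicalSpace G'] [ChartedSpace (EuclideanSpace ℝ (Fin k)) G'] [Group G']
    (ρ : G' →* G) (π : P → M) where
  /-- The total space. -/
  Q : Type uP
  [topologicalSpace : TopologicalSpace Q]
  [t2Space : T2Space Q]
  [secondCountable : SecondCountableTopology Q]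
  [chartedSpace : ChartedSpace (EuclideanSpace ℝ (Fin n)) Q]
  [isManifold : IsManifold (𝓡 n) ∞ Q]
  [mulAction : MulAction G'ᵐᵒᵖ Q]
  /-- The bundle projection. -/
  proj : Q → M
  isPrincipalBundle : IsPrincipalBundle m k n G' proj
  /-- The spinor map. -/
  spinorMap : Q → P
  contMDiff_spinorMap : ContMDiff (𝓡 n) (𝓡 n) ∞ spinorMap
  spinorMap_smul : ∀ (q : Q) (g : G'), spinorMap (q <• g) = spinorMap q <• ρ g
  proj_spinorMap : ∀ q : Q, π (spinorMap q) = proj q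

attribute [instance] SpinorStructure.topologicalSpace SpinorStructure.t2Space
  SpinorStructure.secondCountable SpinorStructure.chartedSpace SpinorStructure.isManifold
  SpinorStructure.mulAction

namespace SpinorStructure

variable {m k n : ℕ} {M : Type uM} {P : Type uP} {G : Type uG} {G' : Type uH}
  [TopologicalSpace M] [ChartedSpace (EuclideanSpace ℝ (Fin m)) M]
  [TopologicalSpace P] [ChartedSpace (EuclideanSpace ℝ (Fin n)) P]
  [Group G] [MulAction Gᵐᵒᵖ P]
  [TopologicalSpace G'] [ChartedSpace (EuclideanSpace ℝ (Fin k)) G'] [Group G']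
  {ρ : G' →* G} {π : P → M}

/-- Two spinor structures are equivalent if there is a principal bundle morphism (over the identity
of `M`) between them that is compatible with the spinor maps. -/
def Equivalent (S T : SpinorStructure m k n ρ π) : Prop :=
  ∃ a : S.Q → T.Q, ContMDiff (𝓡 n) (𝓡 n) ∞ a ∧
    (∀ (q : S.Q) (g : G'), a (q <• g) = a q <• g) ∧
    (∀ q : S.Q, T.proj (a q) = S.proj q) ∧
    ∀ q : S.Q, T.spinorMap (a q) = S.spinorMap q

/-- The subgroup `u_*(π₁(Q, q₀))` of `π₁(P, p₀)`, where `u` is the spinor map and `u q₀ = p₀`. -/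
noncomputable def imageSubgroup (S : SpinorStructure m k n ρ π) {p₀ : P} (q₀ : S.Q)
    (hq₀ : S.spinorMap q₀ = p₀) : Subgroup (FundamentalGroup P p₀) :=
  (FundamentalGroup.mapOfEq ⟨S.spinorMap, S.contMDiff_spinorMap.continuous⟩ hq₀).range

end SpinorStructure

/-- The equivalence classes of spinor structures. -/
def SpinorClass (m k n : ℕ) {M : Type uM} {P : Type uP} {G : Type uG} {G' : Type uH}
    [TopologicalSpace M] [ChartedSpace (EuclideanSpace ℝ (Fin m)) M]
    [TopologicalSpace P] [ChartedSpace (EuclideanSpace ℝ (Fin n)) P]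
    [Group G] [MulAction Gᵐᵒᵖ P]
    [TopologicalSpace G'] [ChartedSpace (EuclideanSpace ℝ (Fin k)) G'] [Group G']
    (ρ : G' →* G) (π : P → M) :=
  Quot (SpinorStructure.Equivalent (m := m) (k := k) (n := n) (ρ := ρ) (π := π))

/-- The equivalence class of a spinor structure. -/
def SpinorStructure.toClass {m k n : ℕ} {M : Type uM} {P : Type uP} {G : Type uG} {G' : Type uH}
    [TopologicalSpace M] [ChartedSpace (EuclideanSpace ℝ (Fin m)) M]
    [TopologicalSpace P] [ChartedSpace (EuclideanSpace ℝ (Fin n)) P]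
    [Group G] [MulAction Gᵐᵒᵖ P]
    [TopologicalSpace G'] [ChartedSpace (EuclideanSpace ℝ (Fin k)) G'] [Group G']
    {ρ : G' →* G} {π : P → M} (S : SpinorStructure m k n ρ π) : SpinorClass m k n ρ π :=
  Quot.mk _ S

namespace IsPrincipalBundle

variable {m k n : ℕ} {M : Type uM} {P : Type uP} {G : Type uG}
  [TopologicalSpace M] [ChartedSpace (EuclideanSpace ℝ (Fin m)) M]
  [TopologicalSpace P] [ChartedSpace (EuclideanSpace ℝ (Fin n)) P]
  [TopologicalSpace G] [ChartedSpace (EuclideanSpace ℝ (Fin k)) G] [Group G]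
  [MulAction Gᵐᵒᵖ P] {π : P → M}

/-- The orbit map `i : G → P`, `i g = p₀ g`. -/
def orbitMap (h : IsPrincipalBundle m k n G π) (p₀ : P) : C(G, P) where
  toFun g := p₀ <• g
  continuous_toFun := h.contMDiff_action.continuous.comp (Continuous.prodMk_right p₀)

/-- The homomorphism `i_* : π₁(G, 1) → π₁(P, p₀)`. -/
noncomputable def orbitMapStar (h : IsPrincipalBundle m k n G π) (p₀ : P) :
    FundamentalGroup G (1 : G) →* FundamentalGroup P p₀ :=
  FundamentalGroup.mapOfEq (h.orbitMap p₀) (one_smul Gᵐᵒᵖ p₀)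

/-- The homomorphism `π_* : π₁(P, p₀) → π₁(M, π p₀)`. -/
noncomputable def projStar (h : IsPrincipalBundle m k n G π) (p₀ : P) :
    FundamentalGroup P p₀ →* FundamentalGroup M (π p₀) :=
  FundamentalGroup.mapOfEq ⟨π, h.contMDiff_proj.continuous⟩ rfl

/-- `π₁(P, p₀)` is the internal direct product of `K` and `i_*(π₁(G, 1))`, and `π_*` maps `K`
isomorphically onto `π₁(M, π p₀)`. -/
structure IsComplement (h : IsPrincipalBundle m k n G π) (p₀ : P)
    (K : Subgroup (FundamentalGroup P p₀)) : Prop where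
  commute : ∀ x ∈ K, ∀ y ∈ (h.orbitMapStar p₀).range, Commute x y
  inf_eq_bot : K ⊓ (h.orbitMapStar p₀).range = ⊥
  sup_eq_top : K ⊔ (h.orbitMapStar p₀).range = ⊤
  bijOn_projStar : Set.BijOn (h.projStar p₀) K Set.univ

/-- The conditions of the existence theorem: `i_*` is an isomorphism onto its image, and this image
has a complement `K` as in `IsComplement`. -/
def ExistenceCondition (h : IsPrincipalBundle m k n G π) (p₀ : P) : Prop :=
  Function.Injective (h.orbitMapStar p₀) ∧ ∃ K, h.IsComplement p₀ K

end IsPrincipalBundle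

/-!
A spinor map `u : Q → P` is a covering map, and its deck transformations are the elements of
`ker ρ ≃ π₁(G)` acting on `Q`. For `u_*(π₁(Q))`, freeness of the action means trivial intersection
with `i_*(π₁(G))` and transitivity on the fibres of `u` means that the two subgroups generate
`π₁(P)`, because the monodromy of an orbit loop `i_*(g)` is the action of the monodromy of `g` along
`ρ`. Conversely, the covering of `P` with fundamental group a complement `K` is a local
diffeomorphism, the action of `G` lifts to an action of the simply connected group `G'`, and the
same two conditions on `K` make the covering a principal `G'`-bundle over `M`. Coverings with the
same image of `π₁` are isomorphic over `P`, and uniqueness of lifts makes the isomorphism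
equivariant, so that `u ↦ u_*(π₁(Q))` is a bijection onto the complements.

Complements are ranges of sections of `π_*`. Its kernel is `i_*(π₁(G))`, which is central by the
Eckmann–Hilton argument, hence two sections differ by a homomorphism `π₁(M) → π₁(G)`.
-/

section Complements

variable {A B C : Type*} [Group A] [Group B] [Group C] {i : A →* B} {p : B →* C}

theorem bijOn_univ_iff_isCompl_ker (hp : Function.Surjective p) {K : Subgroup B} :
    Set.BijOn p K Set.univ ↔ IsCompl K p.ker := by
  have injOn_iff : Set.InjOn p K ↔ Disjoint K p.ker := by
    rw [← Subgroup.subgroupOf_eq_bot.trans disjoint_comm, ← MonoidHom.ker_domRestrict,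
      MonoidHom.ker_eq_bot_iff]
    exact Set.injOn_iff_injective
  have surjOn_iff : Set.SurjOn p K Set.univ ↔ Codisjoint K p.ker := by
    rw [← Subgroup.map_eq_range_iff, MonoidHom.range_eq_top.2 hp, ← Subgroup.coe_eq_univ,
      Subgroup.coe_map, Set.SurjOn, Set.univ_subset_iff]
  rw [isCompl_iff, ← injOn_iff, ← surjOn_iff]
  exact ⟨fun h => ⟨h.injOn, h.surjOn⟩, fun h => ⟨Set.mapsTo_univ _ _, h.1, h.2⟩⟩

theorem bijOn_range_of_leftInverse {s : C →* B} (hs : Function.LeftInverse p s) :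
    Set.BijOn p s.range Set.univ := by
  refine ⟨Set.mapsTo_univ _ _, ?_, fun c _ => ⟨s c, ⟨c, rfl⟩, hs c⟩⟩
  rintro _ ⟨c, rfl⟩ _ ⟨d, rfl⟩ hcd
  rw [hs, hs] at hcd
  rw [hcd]

theorem exists_leftInverse_range_eq {K : Subgroup B} (hK : Set.BijOn p K Set.univ) :
    ∃ s : C →* B, Function.LeftInverse p s ∧ s.range = K := by
  have hbij : Function.Bijective (p.domRestrict K) :=
    ⟨hK.injOn.injective, fun c => (hK.surjOn (Set.mem_univ c)).elim fun k hk => ⟨⟨k, hk.1⟩, hk.2⟩⟩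
  let e : K ≃* C := MulEquiv.ofBijective (p.domRestrict K) hbij
  refine ⟨K.subtype.comp e.symm.toMonoidHom, e.apply_symm_apply, ?_⟩
  rw [MonoidHom.range_comp, MonoidHom.range_eq_top.2 e.symm.surjective, ← MonoidHom.range_eq_map,
    Subgroup.range_subtype]

theorem eq_of_range_le_of_leftInverse {s t : C →* B} (hs : Function.LeftInverse p s)
    (ht : Function.LeftInverse p t) (h : s.range ≤ t.range) : s = t := by
  ext c
  obtain ⟨d, hd⟩ := h ⟨c, rfl⟩
  rw [← hd, show d = c by rw [← ht d, hd, hs]]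

theorem ker_eq_range_of_sup_eq_top {K : Subgroup B} (hi : ∀ x a, Commute x (i a))
    (hpi : ∀ a, p (i a) = 1) (hK : Set.InjOn p K) (hsup : K ⊔ i.range = ⊤) :
    p.ker = i.range := by
  refine le_antisymm (fun x hx => ?_) (by rintro _ ⟨a, rfl⟩; exact hpi a)
  have : i.range.Normal := ⟨by rintro _ ⟨a, rfl⟩ g; exact ⟨a, by rw [(hi g a).eq]; simp⟩⟩
  obtain ⟨k, hk, _, ⟨a, rfl⟩, rfl⟩ :=
    Subgroup.mem_sup_of_normal_right.1 (hsup ▸ Subgroup.mem_top x)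
  have hpk : p k = 1 := by rwa [MonoidHom.mem_ker, map_mul, hpi, mul_one] at hx
  rw [hK hk K.one_mem (hpk.trans (map_one p).symm), one_mul]
  exact ⟨a, rfl⟩

/-- The twist `c ↦ s c * i (φ c)` of a homomorphism `s` by a homomorphism `φ` into the source of a
central homomorphism `i`. Twists of one section of `p` by `φ` are all the sections of `p` when `i`
is a kernel of `p`. -/
def centralTwist (s : C →* B) (hi : ∀ x a, Commute x (i a)) (φ : C →* A) : C →* B where
  toFun c := s c * i (φ c)
  map_one' := by simp
  map_mul' c d := by
    rw [map_mul, map_mul, map_mul, (hi (s d) (φ c)).symm.mul_mul_mul_comm]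

theorem centralTwist_apply (s : C →* B) (hi : ∀ x a, Commute x (i a)) (φ : C →* A) (c : C) :
    centralTwist s hi φ c = s c * i (φ c) := rfl

theorem mem_range_centralTwist {s : C →* B} (hs : Function.LeftInverse p s)
    (hi : ∀ x a, Commute x (i a)) (φ : C →* A) {x : B} :
    x ∈ (centralTwist s hi φ).range ↔ ∃ y ∈ s.range, x = y * i (φ (p y)) := by
  constructor
  · rintro ⟨c, rfl⟩
    exact ⟨s c, ⟨c, rfl⟩, by rw [hs, centralTwist_apply]⟩
  · rintro ⟨_, ⟨c, rfl⟩, rfl⟩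
    exact ⟨c, by rw [hs, centralTwist_apply]⟩

theorem centralTwist_injective (s : C →* B) (hi : ∀ x a, Commute x (i a))
    (hinj : Function.Injective i) : Function.Injective (centralTwist s hi) := fun _ _ h =>
  MonoidHom.ext fun c => hinj (mul_left_cancel (DFunLike.congr_fun h c))

theorem leftInverse_centralTwist {s : C →* B} (hs : Function.LeftInverse p s)
    (hi : ∀ x a, Commute x (i a)) (hpi : ∀ a, p (i a) = 1) (φ : C →* A) :
    Function.LeftInverse p (centralTwist s hi φ) := fun c => by
  rw [centralTwist_apply, map_mul, hpi, mul_one, hs]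

theorem exists_centralTwist_eq {s t : C →* B} (hs : Function.LeftInverse p s)
    (ht : Function.LeftInverse p t) (hi : ∀ x a, Commute x (i a)) (hinj : Function.Injective i)
    (hker : p.ker = i.range) : ∃ φ : C →* A, centralTwist s hi φ = t := by
  have hdiff : ∀ c, (s c)⁻¹ * t c ∈ i.range := fun c => by
    rw [← hker, MonoidHom.mem_ker, map_mul, map_inv, hs, ht, inv_mul_cancel]
  choose φ hφ using hdiff
  have ht_eq : ∀ c, t c = s c * i (φ c) := fun c => by rw [hφ, mul_inv_cancel_left]
  have hφ_mul : ∀ c d, φ (c * d) = φ c * φ d := fun c d => hinj <| by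
    apply mul_left_cancel (a := s (c * d))
    rw [← ht_eq, map_mul, ht_eq, ht_eq, map_mul, map_mul, (hi (s d) (φ c)).symm.mul_mul_mul_comm]
  exact ⟨MonoidHom.mk' φ hφ_mul, MonoidHom.ext fun c => (ht_eq c).symm⟩

/-- The complements of a central kernel `i : A → B` of `p : B → C`, encoded as the subgroups mapped
bijectively by `p`, are parametrised by the homomorphisms `C → A`, once one of them is chosen as the
range of a section `s` of `p`. -/
noncomputable def homEquivBijOn {s : C →* B} (hs : Function.LeftInverse p s)
    (hi : ∀ x a, Commute x (i a)) (hinj : Function.Injective i) (hker : p.ker = i.range) :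
    (C →* A) ≃ {K : Subgroup B // Set.BijOn p K Set.univ} :=
  have hpi : ∀ a, p (i a) = 1 := fun a => hker.ge ⟨a, rfl⟩
  Equiv.ofBijective
    (fun φ => ⟨(centralTwist s hi φ).range,
      bijOn_range_of_leftInverse (leftInverse_centralTwist hs hi hpi φ)⟩)
    ⟨fun φ ψ h => centralTwist_injective s hi hinj <|
        eq_of_range_le_of_leftInverse (leftInverse_centralTwist hs hi hpi φ)
          (leftInverse_centralTwist hs hi hpi ψ) (Subtype.ext_iff.1 h).le,
      fun K => by
        obtain ⟨t, ht, htK⟩ := exists_leftInverse_range_eq K.2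
        obtain ⟨φ, rfl⟩ := exists_centralTwist_eq hs ht hi hinj hker
        exact ⟨φ, Subtype.ext htK⟩⟩

end Complements

/-! ### Monodromy -/

section Monodromy

variable {X Y E F : Type*} [TopologicalSpace X] [TopologicalSpace Y] [TopologicalSpace E]
  [TopologicalSpace F] {p : E → X} (hp : IsCoveringMap p)

include hp in
theorem surjective_of_isCoveringMap [Nonempty E] [PathConnectedSpace X] :
    Function.Surjective p := fun x => by
  obtain ⟨e⟩ := ‹Nonempty E›
  let γ := PathConnectedSpace.somePath (p e) x
  exact ⟨_, (hp.monodromy (.mk γ) ⟨e, rfl⟩).2⟩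

include hp in
theorem t2Space_of_isCoveringMap [T2Space X] : T2Space E := by
  refine ⟨fun a b hab => ?_⟩
  by_cases h : p a = p b
  · exact hp.isSeparatedMap a b h hab
  · exact separated_by_continuous hp.continuous h

include hp in
theorem mem_range_mapOfEq_iff_monodromy_eq {x : X} {e : E} (he : p e = x)
    (γ : FundamentalGroup X x) :
    γ ∈ (FundamentalGroup.mapOfEq ⟨p, hp.continuous⟩ he).range ↔
      hp.monodromy γ ⟨e, he⟩ = ⟨e, he⟩ := by
  subst he
  constructor
  · rintro ⟨Γ, rfl⟩
    rw [FundamentalGroup.mapOfEq_apply, Path.Homotopic.Quotient.cast_rfl_rfl]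
    exact hp.monodromy_map Γ
  · intro h
    refine ⟨(hp.liftPathQuotient γ ⟨e, rfl⟩).cast rfl (congrArg Subtype.val h).symm, ?_⟩
    rw [FundamentalGroup.mapOfEq_apply, Path.Homotopic.Quotient.map_cast,
      hp.map_liftPathQuotient]
    exact (Path.Homotopic.Quotient.cast_cast ..).trans
      ((Path.Homotopic.Quotient.cast_cast ..).trans (Path.Homotopic.Quotient.cast_rfl_rfl γ))

theorem monodromy_surjective [PathConnectedSpace E] {x y : X} (e : p ⁻¹' {x}) (e' : p ⁻¹' {y}) :
    ∃ γ : Path.Homotopic.Quotient x y, hp.monodromy γ e = e' := by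
  obtain ⟨e, rfl⟩ := e
  obtain ⟨e', rfl⟩ := e'
  exact ⟨.mk ((PathConnectedSpace.somePath e e').map hp.continuous), hp.monodromy_map (.mk _)⟩

theorem eq_one_of_monodromy_eq [SimplyConnectedSpace E] {x : X} {e : p ⁻¹' {x}}
    {γ : FundamentalGroup X x} (h : hp.monodromy γ e = e) : γ = 1 := by
  obtain ⟨Γ, rfl⟩ := (mem_range_mapOfEq_iff_monodromy_eq hp e.2 γ).2 h
  rw [Subsingleton.elim Γ 1, map_one]

theorem map_monodromy {q : F → Y} (hq : IsCoveringMap q) (f : C(X, Y)) (f' : C(E, F))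
    (hf : ∀ e, q (f' e) = f (p e)) {x y : X} (γ : Path.Homotopic.Quotient x y) (e : p ⁻¹' {x}) :
    f' (hp.monodromy γ e) = hq.monodromy (γ.map f) ⟨f' e, (hf e).trans (congrArg f e.2)⟩ := by
  obtain ⟨γ, rfl⟩ := Path.Homotopic.Quotient.mk_surjective γ
  have hlift := (hq.eq_liftPath_iff' (γ := f.comp γ)
    (Γ := f'.comp (hp.liftPath γ e (γ.source.trans e.2.symm)))
    ((congrArg f (γ.source.trans e.2.symm)).trans (hf e).symm)).2
      ⟨funext fun t => (hf _).trans (congrArg f (congrFun (hp.liftPath_lifts ..) t)),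
        congrArg f' (hp.liftPath_zero ..)⟩
  exact DFunLike.congr_fun hlift 1

theorem map_monodromy_mapOfEq {q : F → Y} (hq : IsCoveringMap q) (f : C(X, Y)) (f' : C(E, F))
    (hf : ∀ e, q (f' e) = f (p e)) {x : X} {y : Y} (hxy : f x = y) (γ : FundamentalGroup X x)
    (e : p ⁻¹' {x}) (e' : q ⁻¹' {y}) (he : f' e = e') :
    f' (hp.monodromy γ e) = hq.monodromy (FundamentalGroup.mapOfEq f hxy γ) e' := by
  subst hxy
  obtain ⟨_, he'⟩ := e'
  subst he
  rw [FundamentalGroup.mapOfEq_apply, Path.Homotopic.Quotient.cast_rfl_rfl]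
  exact map_monodromy hp hq f f' hf γ e

end Monodromy

section EquivariantCovering

open FundamentalGroup

section Prod

variable {X Y : Type*} [TopologicalSpace X] [TopologicalSpace Y] {x : X} {y : Y}

theorem mapOfEq_id_prodMk_const (γ : FundamentalGroup X x) :
    mapOfEq (y := (x, y)) ((ContinuousMap.id X).prodMk (.const X y)) rfl γ =
      Path.Homotopic.prod γ (1 : FundamentalGroup Y y) := by
  obtain ⟨γ, rfl⟩ := Path.Homotopic.Quotient.mk_surjective γ
  exact mapOfEq_apply ..

theorem mapOfEq_const_prodMk_id (δ : FundamentalGroup Y y) :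
    mapOfEq (y := (x, y)) ((ContinuousMap.const Y x).prodMk (.id Y)) rfl δ =
      Path.Homotopic.prod (1 : FundamentalGroup X x) δ := by
  obtain ⟨δ, rfl⟩ := Path.Homotopic.Quotient.mk_surjective δ
  exact mapOfEq_apply ..

theorem commute_mapOfEq_prodMk (γ : FundamentalGroup X x) (δ : FundamentalGroup Y y) :
    Commute (mapOfEq (y := (x, y)) ((ContinuousMap.id X).prodMk (.const X y)) rfl γ)
      (mapOfEq (y := (x, y)) ((ContinuousMap.const Y x).prodMk (.id Y)) rfl δ) := by
  let pair (a : FundamentalGroup X x) (b : FundamentalGroup Y y) :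
      FundamentalGroup (X × Y) (x, y) := Path.Homotopic.prod a b
  have pair_mul_pair (a a' : FundamentalGroup X x) (b b' : FundamentalGroup Y y) :
      pair a b * pair a' b' = pair (a * a') (b * b') :=
    Path.Homotopic.comp_prod_eq_prod_comp ..
  have hcomm : Commute (pair γ 1) (pair 1 δ) := by
    rw [Commute, SemiconjBy, pair_mul_pair, pair_mul_pair, mul_one, mul_one, one_mul, one_mul]
  rw [mapOfEq_id_prodMk_const, mapOfEq_const_prodMk_id]
  exact hcomm

end Prod

theorem mapOfEq_mapOfEq {X Y Z : Type*} [TopologicalSpace X] [TopologicalSpace Y]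
    [TopologicalSpace Z] (f : C(X, Y)) (g : C(Y, Z)) {x : X} {y : Y} {z : Z} (hf : f x = y)
    (hg : g y = z) (γ : FundamentalGroup X x) :
    mapOfEq g hg (mapOfEq f hf γ) =
      mapOfEq (g.comp f) ((congrArg g hf).trans hg) γ := by
  subst hf hg
  simp only [mapOfEq_apply, Path.Homotopic.Quotient.cast_rfl_rfl]
  exact Path.Homotopic.Quotient.map_comp.symm

theorem mapOfEq_eq_self {X : Type*} [TopologicalSpace X] {x : X} {f : C(X, X)} (hf : ∀ y, f y = y)
    (γ : FundamentalGroup X x) : mapOfEq f (hf x) γ = γ := by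
  obtain rfl : f = ContinuousMap.id X := ContinuousMap.ext hf
  obtain ⟨γ, rfl⟩ := Path.Homotopic.Quotient.mk_surjective γ
  exact mapOfEq_apply _ _ _

theorem mapOfEq_eq_one {X Y : Type*} [TopologicalSpace X] [TopologicalSpace Y] {f : C(X, Y)} {y : Y}
    (hf : ∀ a, f a = y) {x : X} (γ : FundamentalGroup X x) : mapOfEq f (hf x) γ = 1 := by
  obtain rfl : f = ContinuousMap.const X y := ContinuousMap.ext hf
  obtain ⟨γ, rfl⟩ := Path.Homotopic.Quotient.mk_surjective γ
  exact mapOfEq_apply _ _ _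

section Orbit

variable {X G : Type*} [TopologicalSpace X] [TopologicalSpace G] [Group G] [MulAction Gᵐᵒᵖ X]
  [ContinuousSMul Gᵐᵒᵖ X]

/-- The homomorphism `π₁(G, 1) → π₁(X, x)` induced by the orbit map `g ↦ x <• g`. -/
noncomputable def rightOrbitStar (x : X) : FundamentalGroup G (1 : G) →* FundamentalGroup X x :=
  mapOfEq ⟨fun g => x <• g, by fun_prop⟩ (one_smul Gᵐᵒᵖ x)

/-- Eckmann–Hilton: the action induces a homomorphism `π₁(X × G) → π₁(X)`, and in `π₁(X × G)` the
two factors commute. -/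
theorem commute_rightOrbitStar {x : X} (γ : FundamentalGroup X x)
    (g : FundamentalGroup G (1 : G)) : Commute γ (rightOrbitStar x g) := by
  let act : C(X × G, X) := ⟨fun y => y.1 <• y.2, by fun_prop⟩
  have hleft := (mapOfEq_mapOfEq (y := (x, (1 : G))) ((ContinuousMap.id X).prodMk (.const X 1))
    act rfl (one_smul Gᵐᵒᵖ x) γ).trans (mapOfEq_eq_self (fun y => one_smul Gᵐᵒᵖ y) γ)
  have hright := mapOfEq_mapOfEq (y := (x, (1 : G))) ((ContinuousMap.const G x).prodMk (.id G))
    act rfl (one_smul Gᵐᵒᵖ x) g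
  have h := (commute_mapOfEq_prodMk γ g).map (mapOfEq act (one_smul Gᵐᵒᵖ x))
  rwa [hleft, hright] at h

end Orbit

variable {X E G G' : Type*} [TopologicalSpace X] [TopologicalSpace E] [TopologicalSpace G]
  [Group G] [MulAction Gᵐᵒᵖ X] [ContinuousSMul Gᵐᵒᵖ X] [TopologicalSpace G'] [Group G']
  [MulAction G'ᵐᵒᵖ E] [ContinuousSMul G'ᵐᵒᵖ E] {p : E → X} {ρ : G' →* G}
  (hp : IsCoveringMap p) (hρ : IsCoveringMap ρ) (hsmul : ∀ e g, p (e <• g) = p e <• ρ g)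

include hsmul

theorem monodromy_rightOrbitStar {x : X} (e : p ⁻¹' {x}) (g : FundamentalGroup G (1 : G)) :
    (hp.monodromy (rightOrbitStar x g) e : E) =
      (e : E) <• (hρ.monodromy g ⟨1, map_one ρ⟩ : G') :=
  (map_monodromy_mapOfEq hρ hp _ ⟨fun z => (e : E) <• z, by fun_prop⟩
    (fun z => (hsmul e z).trans (congrArg (· <• ρ z) e.2)) _ g ⟨1, map_one ρ⟩ e
    (one_smul G'ᵐᵒᵖ (e : E))).symm

omit [TopologicalSpace G] [ContinuousSMul Gᵐᵒᵖ X] in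
theorem monodromy_smul {z : G'} (hz : ρ z = 1) {x y : X} (γ : Path.Homotopic.Quotient x y)
    {e : E} (he : p e = x) (hez : p (e <• z) = x) :
    (hp.monodromy γ ⟨e <• z, hez⟩ : E) = (hp.monodromy γ ⟨e, he⟩ : E) <• z := by
  have h := map_monodromy hp hp (.id X) ⟨fun e : E => e <• z, by fun_prop⟩
    (fun e => by simp [hsmul, hz]) γ ⟨e, he⟩
  obtain ⟨γ, rfl⟩ := Path.Homotopic.Quotient.mk_surjective γ
  exact h.symm

omit hsmul in
theorem monodromy_mul {x : X} (γ δ : FundamentalGroup X x) (e : p ⁻¹' {x}) :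
    hp.monodromy (γ * δ) e = hp.monodromy γ (hp.monodromy δ e) :=
  hp.monodromy_trans_apply δ γ e

include hp hρ

theorem range_inf_range_rightOrbitStar [SimplyConnectedSpace G'] {x : X} {e : E} (he : p e = x)
    (hfree : ∀ z : G', e <• z = e → z = 1) :
    (mapOfEq ⟨p, hp.continuous⟩ he).range ⊓ (rightOrbitStar (G := G) x).range = ⊥ := by
  rw [eq_bot_iff]
  rintro _ ⟨hrange, g, rfl⟩
  have hfix := congrArg Subtype.val ((mem_range_mapOfEq_iff_monodromy_eq hp he _).1 hrange)
  rw [monodromy_rightOrbitStar hp hρ hsmul] at hfix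
  rw [eq_one_of_monodromy_eq hρ (Subtype.ext (hfree _ hfix)), map_one]
  exact Subgroup.mem_bot.2 rfl

theorem range_sup_range_rightOrbitStar [PathConnectedSpace G'] {x : X} {e : E} (he : p e = x)
    (htrans : ∀ e', p e' = x → ∃ z : G', ρ z = 1 ∧ e <• z = e') :
    (mapOfEq ⟨p, hp.continuous⟩ he).range ⊔ (rightOrbitStar (G := G) x).range = ⊤ := by
  rw [eq_top_iff]
  intro γ _
  obtain ⟨z, hz, hez⟩ := htrans _ (hp.monodromy γ ⟨e, he⟩).2
  obtain ⟨g, hg⟩ := monodromy_surjective hρ ⟨1, map_one ρ⟩ (⟨z, hz⟩ : ρ ⁻¹' {1})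
  have hγg : hp.monodromy γ ⟨e, he⟩ = hp.monodromy (rightOrbitStar x g) ⟨e, he⟩ :=
    Subtype.ext <| by rw [monodromy_rightOrbitStar hp hρ hsmul, hg, hez]
  have hmem : (rightOrbitStar x g)⁻¹ * γ ∈ (mapOfEq ⟨p, hp.continuous⟩ he).range := by
    rw [mem_range_mapOfEq_iff_monodromy_eq hp, monodromy_mul, hγg, ← monodromy_mul,
      inv_mul_cancel]
    exact congrFun hp.monodromy_refl _
  rw [← mul_inv_cancel_left (rightOrbitStar x g) γ]
  exact mul_mem (Subgroup.mem_sup_right ⟨g, rfl⟩) (Subgroup.mem_sup_left hmem)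

theorem eq_one_of_smul_eq [PathConnectedSpace G'] [PathConnectedSpace E] {x : X} {e : E}
    (he : p e = x) (hinj : Function.Injective (rightOrbitStar (G := G) x))
    (hinf : (mapOfEq ⟨p, hp.continuous⟩ he).range ⊓ (rightOrbitStar (G := G) x).range = ⊥)
    {e' : E} {z : G'} (hz : ρ z = 1) (h : e' <• z = e') : z = 1 := by
  have he_smul : e <• z = e := by
    obtain ⟨γ, hγ⟩ := monodromy_surjective hp ⟨e', rfl⟩ (⟨e, he⟩ : p ⁻¹' {x})
    have hmon := monodromy_smul hp hsmul hz γ rfl (congrArg p h)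
    simp only [h, hγ] at hmon
    exact hmon.symm
  obtain ⟨g, hg⟩ := monodromy_surjective hρ ⟨1, map_one ρ⟩ (⟨z, hz⟩ : ρ ⁻¹' {1})
  have hmem : rightOrbitStar x g ∈ (mapOfEq ⟨p, hp.continuous⟩ he).range := by
    rw [mem_range_mapOfEq_iff_monodromy_eq hp, Subtype.ext_iff,
      monodromy_rightOrbitStar hp hρ hsmul, hg, he_smul]
  have hg_one : g = (1 : FundamentalGroup G 1) :=
    hinj <| (Subgroup.mem_bot.1 (hinf ▸ ⟨hmem, g, rfl⟩)).trans (map_one _).symm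
  rw [hg_one] at hg
  exact (congrArg Subtype.val hg).symm.trans (congrArg Subtype.val (congrFun hρ.monodromy_refl _))

theorem exists_smul_eq_of_sup_eq_top [PathConnectedSpace E] {x : X} {e : E} (he : p e = x)
    (hsup : (mapOfEq ⟨p, hp.continuous⟩ he).range ⊔ (rightOrbitStar (G := G) x).range = ⊤)
    {e₁ e₂ : E} (h : p e₁ = p e₂) : ∃ z : G', ρ z = 1 ∧ e₁ <• z = e₂ := by
  obtain ⟨γ, hγ⟩ := monodromy_surjective hp ⟨e₁, h⟩ (⟨e, he⟩ : p ⁻¹' {x})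
  obtain ⟨(δ : FundamentalGroup X x), hδ⟩ :=
    monodromy_surjective hp ⟨e, he⟩ (hp.monodromy γ ⟨e₂, rfl⟩)
  obtain ⟨_, ⟨g, rfl⟩, k, hk, rfl⟩ : ∃ a ∈ (rightOrbitStar (G := G) x).range,
      ∃ k ∈ (mapOfEq ⟨p, hp.continuous⟩ he).range, a * k = δ := by
    have hnormal : (rightOrbitStar (G := G) x).range.Normal := ⟨by
      rintro _ ⟨g, rfl⟩ δ
      rw [(commute_rightOrbitStar δ g).eq, mul_inv_cancel_right]
      exact ⟨g, rfl⟩⟩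
    rw [← Subgroup.mem_sup_of_normal_left, sup_comm, hsup]
    exact Subgroup.mem_top δ
  rw [mem_range_mapOfEq_iff_monodromy_eq hp] at hk
  rw [monodromy_mul, hk] at hδ
  let z : ρ ⁻¹' {1} := hρ.monodromy g ⟨1, map_one ρ⟩
  have hz : ρ z = 1 := z.2
  have hez := congrArg Subtype.val hδ
  rw [monodromy_rightOrbitStar hp hρ hsmul] at hez
  have hsmul_z : hp.monodromy γ ⟨e₁ <• (z : G'), by simp [hsmul, hz, h]⟩ =
      hp.monodromy γ ⟨e₂, rfl⟩ :=
    Subtype.ext ((monodromy_smul hp hsmul hz γ h _).trans (by rw [hγ, ← hez]))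
  exact ⟨z, hz, congrArg Subtype.val ((hp.monodromy_bijective γ).1 hsmul_z)⟩

end EquivariantCovering

section LiftedAction

open FundamentalGroup

variable {X E : Type*} [TopologicalSpace X] [TopologicalSpace E] {p : E → X}

theorem isCoveringMap_of_isLocalHomeomorph_of_orbit {H : Type*} [Group H] [MulAction H E]
    [ContinuousConstSMul H E] [IsCancelSMul H E] (hp : IsLocalHomeomorph p)
    (hsurj : Function.Surjective p)
    (horbit : ∀ {e e' : E}, p e = p e' ↔ e ∈ MulAction.orbit H e') : IsCoveringMap p := by
  suffices IsQuotientCoveringMap p H from this.isCoveringMap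
  refine { toIsQuotientMap := hp.isOpenMap.isQuotientMap hp.continuous hsurj
           apply_eq_iff_mem_orbit := horbit
           disjoint := fun e => ?_ }
  obtain ⟨φ, he, rfl⟩ := hp e
  refine ⟨φ.source, φ.open_source.mem_nhds he, ?_⟩
  rintro g ⟨_, ⟨e', he', rfl⟩, hge'⟩
  have hfix : g • e' = e' := φ.injOn hge' he' (horbit.2 ⟨g, rfl⟩)
  exact IsCancelSMul.right_cancel g 1 e' (hfix.trans (one_smul H e').symm)

variable [PathConnectedSpace E] [LocallyPathConnectedSpace E] (hp : IsCoveringMap p)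

include hp

theorem exists_lift_prod {Y : Type*} [TopologicalSpace Y] [SimplyConnectedSpace Y]
    [LocallyPathConnectedSpace Y] (f : C(E × Y, X)) (y₀ : Y) (hf : ∀ e, f (e, y₀) = p e) :
    ∃ μ : C(E × Y, E), (∀ e, μ (e, y₀) = e) ∧ ∀ z, p (μ z) = f z := by
  obtain ⟨e₀⟩ : Nonempty E := inferInstance
  let incl : C(E, E × Y) := (ContinuousMap.id E).prodMk (.const E y₀)
  have incl_fst (γ : FundamentalGroup (E × Y) (e₀, y₀)) :
      ∃ δ, mapOfEq (y := (e₀, y₀)) incl rfl δ = γ := by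
    refine ⟨Path.Homotopic.projLeft γ, (mapOfEq_id_prodMk_const _).trans ?_⟩
    rw [Subsingleton.elim (1 : FundamentalGroup Y y₀) (Path.Homotopic.projRight γ)]
    exact Path.Homotopic.prod_projLeft_projRight γ
  have hrange : (map f (e₀, y₀)).range ≤ (mapOfEq ⟨p, hp.continuous⟩ (hf e₀).symm).range := by
    rintro _ ⟨γ, rfl⟩
    obtain ⟨δ, rfl⟩ := incl_fst γ
    have hcomp : f.comp incl = ⟨p, hp.continuous⟩ := ContinuousMap.ext hf
    refine ⟨δ, ?_⟩
    simp only [← hcomp, ← mapOfEq_mapOfEq incl f (y := (e₀, y₀)) rfl rfl δ]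
    rw [mapOfEq_apply, Path.Homotopic.Quotient.cast_rfl_rfl]
    rfl
  obtain ⟨μ, ⟨hμ₀, hμ⟩, -⟩ := hp.existsUnique_continuousMap_lifts_of_range_le (hf e₀).symm hrange
  refine ⟨μ, fun e => congrFun (hp.eq_of_comp_eq (μ.continuous.comp (Continuous.prodMk_left y₀))
    continuous_id (funext fun e => ?_) e₀ hμ₀) e, congrFun hμ⟩
  exact (congrFun hμ (e, y₀)).trans (hf e)

theorem exists_mulAction_lift {G G' : Type*} [TopologicalSpace G] [Group G] [MulAction Gᵐᵒᵖ X]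
    [ContinuousSMul Gᵐᵒᵖ X] [TopologicalSpace G'] [Group G'] [ContinuousMul G']
    [SimplyConnectedSpace G'] [LocallyPathConnectedSpace G'] {ρ : G' →* G} (hρ : Continuous ρ) :
    ∃ _ : MulAction G'ᵐᵒᵖ E, ContinuousSMul G'ᵐᵒᵖ E ∧
      ∀ (e : E) (g : G'), p (e <• g) = p e <• ρ g := by
  have hp' := hp.continuous
  obtain ⟨μ, μ_one, hμ⟩ := exists_lift_prod hp ⟨fun z : E × G' => p z.1 <• ρ z.2, by fun_prop⟩ 1
    (fun e => by simp)
  have hμ (e g) : p (μ (e, g)) = p e <• ρ g := hμ (e, g)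
  obtain ⟨e₀⟩ : Nonempty E := inferInstance
  have μ_mul : (fun z : E × G' × G' => μ (μ (z.1, z.2.1), z.2.2)) =
      fun z => μ (z.1, z.2.1 * z.2.2) :=
    hp.eq_of_comp_eq (by fun_prop) (by fun_prop) (funext fun z => by simp [hμ, mul_smul])
      (e₀, 1, 1) (by simp [μ_one])
  let act : MulAction G'ᵐᵒᵖ E :=
    { smul := fun g e => μ (e, g.unop)
      one_smul := μ_one
      mul_smul := fun g g' e => (congrFun μ_mul (e, g'.unop, g.unop)).symm }
  exact ⟨act, ⟨μ.continuous.comp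
    (continuous_snd.prodMk (MulOpposite.continuous_unop.comp continuous_fst))⟩, hμ⟩

end LiftedAction

/-! ### Coverings with prescribed fundamental group -/

section CoveringOfSubgroup

open scoped Topology
open Path (Homotopic.Quotient)
open Path.Homotopic.Quotient

variable {X : Type*} [TopologicalSpace X]

theorem trans_trans_trans_symm {a b c d : X} (p : Homotopic.Quotient a b)
    (q : Homotopic.Quotient d b) (r : Homotopic.Quotient b c) :
    (p.trans r).trans (q.trans r).symm = p.trans q.symm := by
  have hsymm : (q.trans r).symm = r.symm.trans q.symm := by
    obtain ⟨q, rfl⟩ := mk_surjective q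
    obtain ⟨r, rfl⟩ := mk_surjective r
    simp only [← mk_trans, ← mk_symm, Path.trans_symm]
  rw [hsymm, trans_assoc, ← trans_assoc r, trans_symm, refl_trans]

theorem eventually_exists_path [LocallyPathConnectedSpace X] {U : Set X} (hU : IsOpen U) {x : X}
    (hx : x ∈ U) : ∀ᶠ y in 𝓝 x, ∃ σ : Path x y, ∀ t, σ t ∈ U := by
  filter_upwards [pathComponentIn_mem_nhds (hU.mem_nhds hx)] with y hy using hy

theorem eventually_forall_subpath_mem {x y : X} (γ : Path x y) {U : Set X} (hU : IsOpen U)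
    {t : unitInterval} (ht : γ t ∈ U) : ∀ᶠ t' in 𝓝 t, ∀ s, γ.subpath t t' s ∈ U := by
  have hcont : Continuous fun z : unitInterval × unitInterval => γ.subpath t z.1 z.2 :=
    γ.subpath_continuous_family.comp
      (continuous_const.prodMk (continuous_fst.prodMk continuous_snd))
  have hmem (s) : ∀ᶠ z : unitInterval × unitInterval in 𝓝 (t, s), γ.subpath t z.1 z.2 ∈ U :=
    hcont.continuousAt.eventually_mem (hU.mem_nhds (by simpa [Path.subpath_self] using ht))
  simpa using isCompact_univ.eventually_forall_of_forall_eventually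
    (P := fun t' s => γ.subpath t t' s ∈ U) fun s _ => hmem s

/-- Open neighbourhoods `nhd i` of the points `i` together with classes of paths `path i x` from
`x₀` to `x`, such that for fixed `i` these classes differ by paths inside `nhd i`. The covering
space which belongs to a subgroup of `π₁(X, x₀)` is trivialised over `nhd i` by the `path i x`. -/
structure PathFrame (x₀ : X) where
  nhd : X → Set X
  isOpen_nhd : ∀ i, IsOpen (nhd i)
  mem_nhd : ∀ i, i ∈ nhd i
  path : ∀ _ x : X, Homotopic.Quotient x₀ x
  path_eq_trans : ∀ (i x y : X) (σ : Path x y), (∀ t, σ t ∈ nhd i) →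
    path i y = (path i x).trans (mk σ)

theorem exists_path_eq_trans [PathConnectedSpace X] (x₀ : X) (U : Set X)
    [SimplyConnectedSpace U] :
    ∃ w : ∀ x, Homotopic.Quotient x₀ x, ∀ (x y : X) (σ : Path x y), (∀ t, σ t ∈ U) →
      w y = (w x).trans (mk σ) := by
  classical
  obtain ⟨i⟩ : Nonempty U := inferInstance
  let w₀ : Homotopic.Quotient x₀ i.1 := mk (PathConnectedSpace.somePath x₀ i.1)
  let w : ∀ x, Homotopic.Quotient x₀ x := fun x =>
    if hx : x ∈ U then
      w₀.trans (mk ((PathConnectedSpace.somePath i ⟨x, hx⟩).map continuous_subtype_val))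
    else mk (PathConnectedSpace.somePath x₀ x)
  have w_eq (x : U) (τ : Path i x) : w x = w₀.trans (mk (τ.map continuous_subtype_val)) := by
    simp only [w, dif_pos x.2]
    congr 1
    exact eq.2 ((SimplyConnectedSpace.paths_homotopic _ τ).map ⟨_, continuous_subtype_val⟩)
  refine ⟨w, fun x y σ hσ => ?_⟩
  have hx : x ∈ U := by simpa using hσ 0
  have hy : y ∈ U := by simpa using hσ 1
  let τ : Path i ⟨x, hx⟩ := PathConnectedSpace.somePath _ _
  let σ' : Path (⟨x, hx⟩ : U) ⟨y, hy⟩ :=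
    ⟨⟨fun t => ⟨σ t, hσ t⟩, by fun_prop⟩, Subtype.ext σ.source, Subtype.ext σ.target⟩
  have hσ' : σ'.map continuous_subtype_val = σ := rfl
  rw [w_eq ⟨x, hx⟩ τ, w_eq ⟨y, hy⟩ (τ.trans σ'), Path.map_trans, mk_trans, trans_assoc, hσ']

theorem nonempty_pathFrame [PathConnectedSpace X] (x₀ : X)
    (hX : ∀ x : X, ∃ U : Set X, IsOpen U ∧ x ∈ U ∧ SimplyConnectedSpace U) :
    Nonempty (PathFrame x₀) := by
  choose U hU hxU hsc using hX
  choose w hw using fun i => exists_path_eq_trans x₀ (U i)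
  exact ⟨⟨U, hU, hxU, w, hw⟩⟩

/-- The cosets of a subgroup of the fundamental group with the discrete topology: the fibre of the
covering space which belongs to this subgroup. -/
def CosetFiber {x₀ : X} (K : Subgroup (FundamentalGroup X x₀)) := FundamentalGroup X x₀ ⧸ K

namespace CosetFiber

variable {x₀ : X} {K : Subgroup (FundamentalGroup X x₀)}

instance : TopologicalSpace (CosetFiber K) := ⊥

instance : DiscreteTopology (CosetFiber K) := ⟨rfl⟩

noncomputable instance : MulAction (FundamentalGroup X x₀) (CosetFiber K) :=
  inferInstanceAs (MulAction (FundamentalGroup X x₀) (FundamentalGroup X x₀ ⧸ K))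

variable (K) in
/-- The coset of a class of loops. -/
noncomputable def mk (w : Homotopic.Quotient x₀ x₀) : CosetFiber K :=
  QuotientGroup.mk (s := K) (w : FundamentalGroup X x₀)

theorem mk_surjective : Function.Surjective (CosetFiber.mk K) :=
  QuotientGroup.mk_surjective (s := K)

theorem mk_eq_mk_iff {v w : Homotopic.Quotient x₀ x₀} :
    CosetFiber.mk K v = CosetFiber.mk K w ↔ FundamentalGroup.fromPath (w.trans v.symm) ∈ K :=
  QuotientGroup.eq (s := K) (a := FundamentalGroup.fromPath v) (b := FundamentalGroup.fromPath w)

end CosetFiber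

namespace PathFrame

variable {x₀ : X} (F : PathFrame x₀) (K : Subgroup (FundamentalGroup X x₀))

/-- The loop along `path i x` and back along `path j x`: the coordinate change from the `i`-th to
the `j`-th trivialisation. -/
noncomputable def transition (i j x : X) : FundamentalGroup X x₀ :=
  (F.path i x).trans (F.path j x).symm

theorem transition_self (i x : X) : F.transition i i x = 1 := trans_symm _

theorem transition_mul (i j l x : X) :
    F.transition j l x * F.transition i j x = F.transition i l x := by
  change ((F.path i x).trans (F.path j x).symm).trans
    ((F.path j x).trans (F.path l x).symm) = (F.path i x).trans (F.path l x).symm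
  rw [trans_assoc, ← trans_assoc (F.path j x).symm, symm_trans, refl_trans]

theorem transition_eq_of_path {i j x y : X} (σ : Path x y) (hi : ∀ t, σ t ∈ F.nhd i)
    (hj : ∀ t, σ t ∈ F.nhd j) : F.transition i j y = F.transition i j x := by
  rw [transition, F.path_eq_trans i x y σ hi, F.path_eq_trans j x y σ hj, trans_trans_trans_symm]
  rfl

variable [LocallyPathConnectedSpace X]

theorem eventually_transition_eq {i j x : X} (hi : x ∈ F.nhd i) (hj : x ∈ F.nhd j) :
    ∀ᶠ y in 𝓝 x, F.transition i j y = F.transition i j x := by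
  filter_upwards [eventually_exists_path ((F.isOpen_nhd i).inter (F.isOpen_nhd j)) ⟨hi, hj⟩]
    with y ⟨σ, hσ⟩
  exact F.transition_eq_of_path σ (fun t => (hσ t).1) fun t => (hσ t).2

/-- The gluing data of the covering space which belongs to the subgroup `K`. -/
noncomputable def core : FiberBundleCore X X (CosetFiber K) where
  baseSet := F.nhd
  isOpen_baseSet := F.isOpen_nhd
  indexAt := id
  mem_baseSet_at := F.mem_nhd
  coordChange i j x v := F.transition i j x • v
  coordChange_self i x _ v := by rw [transition_self, one_smul]
  continuousOn_coordChange i j := by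
    rintro ⟨x, v⟩ ⟨⟨hi, hj⟩, -⟩
    have hcont : ContinuousAt (fun z : X × CosetFiber K => F.transition i j x • z.2) (x, v) :=
      (continuous_of_discreteTopology.comp continuous_snd).continuousAt
    refine (hcont.congr ?_).continuousWithinAt
    filter_upwards [continuous_fst.continuousAt.eventually (F.eventually_transition_eq hi hj)]
      with z hz
    rw [hz]
  coordChange_comp i j l x _ v := by rw [← mul_smul, transition_mul]

theorem isCoveringMap_core : IsCoveringMap (F.core K).proj :=
  FiberBundle.isCoveringMap (F := CosetFiber K) (E := (F.core K).Fiber)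

/-- The point over `x` given by a class of paths from `x₀` to `x`. -/
noncomputable def pt (x : X) (w : Homotopic.Quotient x₀ x) : (F.core K).TotalSpace :=
  ⟨x, CosetFiber.mk K (w.trans (F.path x x).symm)⟩

theorem exists_pt_eq (e : (F.core K).TotalSpace) : ∃ x w, F.pt K x w = e := by
  obtain ⟨x, v⟩ := e
  obtain ⟨w, rfl⟩ := CosetFiber.mk_surjective v
  refine ⟨x, w.trans (F.path x x), ?_⟩
  rw [pt, trans_assoc, trans_symm, trans_refl]

theorem pt_eq_pt_iff {x : X} {v w : Homotopic.Quotient x₀ x} :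
    F.pt K x v = F.pt K x w ↔ FundamentalGroup.fromPath (w.trans v.symm) ∈ K := by
  rw [← trans_trans_trans_symm w v (F.path x x).symm, ← CosetFiber.mk_eq_mk_iff]
  exact ⟨fun h => eq_of_heq (Bundle.TotalSpace.mk.inj h).2,
    congrArg (Bundle.TotalSpace.mk (E := (F.core K).Fiber) x)⟩

theorem continuousAt_pt {A : Type*} [TopologicalSpace A] {f : A → X} {a : A}
    (w : ∀ a, Homotopic.Quotient x₀ (f a)) (hf : ContinuousAt f a)
    (hw : ∀ᶠ b in 𝓝 a, ∃ σ : Path (f a) (f b), (∀ t, σ t ∈ F.nhd (f a)) ∧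
      w b = (w a).trans (.mk σ)) : ContinuousAt (fun b => F.pt K (f b) (w b)) a := by
  rw [FiberBundle.continuousAt_totalSpace]
  refine ⟨hf, ContinuousAt.congr
    (continuousAt_const (y := CosetFiber.mk K ((w a).trans (F.path (f a) (f a)).symm))) ?_⟩
  filter_upwards [hw] with b ⟨σ, hσ, hwb⟩
  change _ = CosetFiber.mk K (((w b).trans (F.path (f b) (f b)).symm).trans
    ((F.path (f b) (f b)).trans (F.path (f a) (f b)).symm))
  rw [trans_assoc, ← trans_assoc (F.path (f b) (f b)).symm, symm_trans, refl_trans, hwb,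
    F.path_eq_trans (f a) (f a) (f b) σ hσ, trans_trans_trans_symm]

theorem exists_path_pt {x y : X} (γ : Path x y) (w : Homotopic.Quotient x₀ x) :
    ∃ Γ : Path (F.pt K x w) (F.pt K y (w.trans (.mk γ))), ∀ t, (Γ t).proj = γ t := by
  obtain ⟨γ, rfl, rfl⟩ := γ
  let γ' : Path (γ 0) (γ 1) := ⟨γ, rfl, rfl⟩
  have hcont : Continuous fun t => F.pt K (γ t) (w.trans (.mk (γ'.subpath 0 t))) := by
    refine continuous_iff_continuousAt.2 fun t => F.continuousAt_pt K _ γ.continuous.continuousAt ?_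
    filter_upwards [eventually_forall_subpath_mem γ' (F.isOpen_nhd (γ t)) (F.mem_nhd (γ t))]
      with t' ht'
    refine ⟨γ'.subpath t t', ht', ?_⟩
    rw [trans_assoc, ← mk_trans, eq.2 ⟨Path.Homotopy.subpathTransSubpath γ' 0 t t'⟩]
  refine ⟨⟨⟨_, hcont⟩, ?_, ?_⟩, fun t => rfl⟩
  · change F.pt K (γ 0) (w.trans (.mk (γ'.subpath 0 0))) = _
    rw [Path.subpath_self]
    exact congrArg (F.pt K (γ 0)) (trans_refl w)
  · change F.pt K (γ 1) (w.trans (.mk (γ'.subpath 0 1))) = _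
    rw [Path.subpath_zero_one]
    rfl

theorem monodromy_pt {x y : X} (γ : Homotopic.Quotient x y) (w : Homotopic.Quotient x₀ x) :
    (F.isCoveringMap_core K).monodromy γ ⟨F.pt K x w, rfl⟩ = ⟨F.pt K y (w.trans γ), rfl⟩ := by
  obtain ⟨γ, rfl⟩ := mk_surjective γ
  obtain ⟨Γ, hΓ⟩ := F.exists_path_pt K γ w
  have hmap : (Homotopic.Quotient.mk Γ).map ⟨_, (F.isCoveringMap_core K).continuous⟩ = .mk γ :=
    congrArg Homotopic.Quotient.mk (Path.ext (funext hΓ))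
  have h := (F.isCoveringMap_core K).monodromy_map (Homotopic.Quotient.mk Γ)
  rwa [hmap] at h

theorem range_mapOfEq_core {e : (F.core K).TotalSpace} (he : F.pt K x₀ (.refl x₀) = e)
    (hproj : (F.core K).proj e = x₀) :
    (FundamentalGroup.mapOfEq ⟨(F.core K).proj, (F.isCoveringMap_core K).continuous⟩ hproj).range =
      K := by
  subst he
  ext γ
  have hrefl : (Homotopic.Quotient.refl x₀).symm = .refl x₀ := by
    rw [← mk_refl, ← mk_symm, Path.refl_symm]
  rw [mem_range_mapOfEq_iff_monodromy_eq (F.isCoveringMap_core K), monodromy_pt, Subtype.ext_iff,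
    eq_comm, pt_eq_pt_iff, refl_trans, hrefl, trans_refl]

theorem pathConnectedSpace_core : PathConnectedSpace (F.core K).TotalSpace := by
  refine pathConnectedSpace_iff_univ.2 ⟨F.pt K x₀ (.refl x₀), Set.mem_univ _, fun {e} _ => ?_⟩
  obtain ⟨x, w, rfl⟩ := F.exists_pt_eq K e
  obtain ⟨γ, rfl⟩ := mk_surjective w
  obtain ⟨Γ, -⟩ := F.exists_path_pt K γ (.refl x₀)
  rw [refl_trans] at Γ
  exact joinedIn_univ.2 ⟨Γ⟩

end PathFrame

theorem exists_isCoveringMap_range_eq {X : Type uP} [TopologicalSpace X] [PathConnectedSpace X]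
    [LocallyPathConnectedSpace X]
    (hX : ∀ x : X, ∃ U : Set X, IsOpen U ∧ x ∈ U ∧ SimplyConnectedSpace U) {x₀ : X}
    (K : Subgroup (FundamentalGroup X x₀)) :
    ∃ (E : Type uP) (_ : TopologicalSpace E) (p : E → X) (hp : IsCoveringMap p) (e₀ : E)
      (he₀ : p e₀ = x₀), PathConnectedSpace E ∧
        (FundamentalGroup.mapOfEq ⟨p, hp.continuous⟩ he₀).range = K := by
  obtain ⟨F⟩ := nonempty_pathFrame x₀ hX
  exact ⟨(F.core K).TotalSpace, inferInstance, (F.core K).proj, F.isCoveringMap_core K,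
    F.pt K x₀ (.refl x₀), rfl, F.pathConnectedSpace_core K, F.range_mapOfEq_core K rfl rfl⟩

theorem exists_simplyConnected_nhd {V H : Type*} [NormedAddCommGroup V] [NormedSpace ℝ V]
    [TopologicalSpace H] [ChartedSpace V H] (x : H) :
    ∃ U : Set H, IsOpen U ∧ x ∈ U ∧ SimplyConnectedSpace U := by
  let e := chartAt V x
  obtain ⟨r, hr, hball⟩ := Metric.isOpen_iff.1 e.open_target (e x) (mem_chart_target V x)
  have : ContractibleSpace (Metric.ball (e x) r) :=
    (convex_ball (e x) r).contractibleSpace ⟨e x, Metric.mem_ball_self hr⟩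
  have himage := e.symm_image_eq_source_inter_preimage hball
  refine ⟨e.symm '' Metric.ball (e x) r, ?_, ?_, ?_⟩
  · exact himage ▸ e.isOpen_inter_preimage Metric.isOpen_ball
  · exact himage ▸ ⟨mem_chart_source V x, Metric.mem_ball_self hr⟩
  · exact (e.symm.homeomorphOfImageSubsetSource hball rfl).symm.toHomotopyEquiv.simplyConnectedSpace

end CoveringOfSubgroup

/-! ### Local diffeomorphisms -/

section LocalDiffeomorph

open scoped Topology

variable {𝕜 : Type*} [NontriviallyNormedField 𝕜]
  {E : Type*} [NormedAddCommGroup E] [NormedSpace 𝕜 E] {H : Type*} [TopologicalSpace H]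
  {I : ModelWithCorners 𝕜 E H} {X : Type*} [TopologicalSpace X] [ChartedSpace H X]
  {E' : Type*} [NormedAddCommGroup E'] [NormedSpace 𝕜 E'] {H' : Type*} [TopologicalSpace H']
  {J : ModelWithCorners 𝕜 E' H'} {Y : Type*} [TopologicalSpace Y] [ChartedSpace H' Y]
  {E'' : Type*} [NormedAddCommGroup E''] [NormedSpace 𝕜 E''] {H'' : Type*} [TopologicalSpace H'']
  {L : ModelWithCorners 𝕜 E'' H''} {Z : Type*} [TopologicalSpace Z] [ChartedSpace H'' Z]
  {r : WithTop ℕ∞} {f : X → Y} {x : X}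

theorem isLocalDiffeomorphAt_of_contMDiffOn {g : Y → X} {A : Set X} {B : Set Y}
    (hA : IsOpen A) (hB : IsOpen B) (hxA : x ∈ A) (hxB : f x ∈ B)
    (hf : ContMDiffOn I J r f A) (hg : ContMDiffOn J I r g B)
    (hgf : ∀ a ∈ A, f a ∈ B → g (f a) = a) (hfg : ∀ b ∈ B, g b ∈ A → f (g b) = b) :
    IsLocalDiffeomorphAt I J r f x :=
  ⟨{ toFun := f
     invFun := g
     source := A ∩ f ⁻¹' B
     target := B ∩ g ⁻¹' A
     map_source' := fun a ha => ⟨ha.2, by simpa only [Set.mem_preimage, hgf a ha.1 ha.2] using ha.1⟩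
     map_target' := fun b hb => ⟨hb.2, by simpa only [Set.mem_preimage, hfg b hb.1 hb.2] using hb.1⟩
     left_inv' := fun a ha => hgf a ha.1 ha.2
     right_inv' := fun b hb => hfg b hb.1 hb.2
     open_source := hf.continuousOn.isOpen_inter_preimage hA hB
     open_target := hg.continuousOn.isOpen_inter_preimage hB hA
     contMDiffOn_toFun := hf.mono Set.inter_subset_left
     contMDiffOn_invFun := hg.mono Set.inter_subset_left }, ⟨hxA, hxB⟩, fun _ _ => rfl⟩

theorem isLocalDiffeomorphAt_congr {g : X → Y} (hf : IsLocalDiffeomorphAt I J r f x)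
    (hfg : g =ᶠ[𝓝 x] f) : IsLocalDiffeomorphAt I J r g x := by
  obtain ⟨Φ, hx, hΦ⟩ := hf
  obtain ⟨U, hU, hUo, hxU⟩ := eventually_nhds_iff.1 hfg
  have hgΦ : Set.EqOn g Φ (Φ.source ∩ U) := fun a ha => (hU a ha.2).trans (hΦ ha.1)
  refine isLocalDiffeomorphAt_of_contMDiffOn (g := Φ.symm) (Φ.open_source.inter hUo) Φ.open_target
    ⟨hx, hxU⟩ ?_ ((Φ.contMDiffOn.mono Set.inter_subset_left).congr hgΦ) Φ.symm.contMDiffOn ?_ ?_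
  · exact hgΦ ⟨hx, hxU⟩ ▸ Φ.map_source hx
  · exact fun a ha _ => by rw [hgΦ ha]; exact Φ.left_inv ha.1
  · exact fun b hb ha => (hgΦ ha).trans (Φ.right_inv hb)

theorem isLocalDiffeomorphAt_of_comp_left {p : Y → Z} (hf : ContinuousAt f x)
    (hp : IsLocalDiffeomorphAt J L r p (f x)) (hpf : IsLocalDiffeomorphAt I L r (p ∘ f) x) :
    IsLocalDiffeomorphAt I J r f x := by
  refine isLocalDiffeomorphAt_congr (hpf.comp J Y hp.localInverse_isLocalDiffeomorphAt) ?_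
  filter_upwards [hf.eventually hp.localInverse_eventuallyEq_left] with a ha using ha.symm

theorem isLocalDiffeomorphAt_of_comp_right {p : Y → Z} (hf : IsLocalDiffeomorphAt I J r f x)
    (hpf : IsLocalDiffeomorphAt I L r (p ∘ f) x) : IsLocalDiffeomorphAt J L r p (f x) := by
  have hx : hf.localInverse (f x) = x := hf.localInverse_left_inv hf.localInverse_mem_target
  have hcomp := hf.localInverse_isLocalDiffeomorphAt.comp L Z (hx.symm ▸ hpf)
  refine isLocalDiffeomorphAt_congr hcomp ?_
  filter_upwards [hf.localInverse_eventuallyEq_right] with b hb using (congrArg p hb).symm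

theorem contMDiffAt_of_eventually_leftInverse {g : Y → X} (hf : IsLocalDiffeomorphAt I J r f x)
    (hgf : ∀ᶠ a in 𝓝 x, g (f a) = a) : ContMDiffAt J I r g (f x) := by
  refine hf.localInverse_contMDiffAt.congr_of_eventuallyEq ?_
  have hx : hf.localInverse (f x) = x := hf.localInverse_left_inv hf.localInverse_mem_target
  have hcont : Filter.Tendsto hf.localInverse (𝓝 (f x)) (𝓝 x) := by
    simpa only [hx] using hf.localInverse_contMDiffAt.continuousAt.tendsto
  filter_upwards [hf.localInverse_eventuallyEq_right, hcont.eventually hgf] with b hb hgb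
  rw [← hgb]
  exact congrArg g hb.symm

theorem contMDiff_of_comp {p : Y → Z} (hp : IsLocalDiffeomorph J L r p) (hf : Continuous f)
    (hpf : ContMDiff I L r (p ∘ f)) : ContMDiff I J r f := fun x => by
  refine ((hp (f x)).localInverse_contMDiffAt.comp x (hpf x)).congr_of_eventuallyEq ?_
  filter_upwards [hf.continuousAt.eventually (hp (f x)).localInverse_eventuallyEq_left]
    with a ha using ha.symm

theorem isLocalDiffeomorphAt_prodMap_id {z : Z} (hf : IsLocalDiffeomorphAt I J r f x) :
    IsLocalDiffeomorphAt (L.prod I) (L.prod J) r (Prod.map (id : Z → Z) f) (z, x) := by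
  obtain ⟨Φ, hx, hΦ⟩ := hf
  have hfx : f x ∈ Φ.target := (hΦ hx).symm ▸ Φ.map_source hx
  refine isLocalDiffeomorphAt_of_contMDiffOn (g := Prod.map id Φ.symm)
    (isOpen_univ.prod Φ.open_source) (isOpen_univ.prod Φ.open_target) ⟨trivial, hx⟩
    ⟨trivial, hfx⟩ (contMDiffOn_id.prodMap (Φ.contMDiffOn.congr hΦ))
    (contMDiffOn_id.prodMap Φ.symm.contMDiffOn) ?_ ?_
  · exact fun a ha _ => Prod.ext rfl (by simpa [hΦ ha.2] using Φ.left_inv ha.2)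
  · exact fun b hb ha => Prod.ext rfl (by simpa using (hΦ ha.2).trans (Φ.right_inv hb.2))

end LocalDiffeomorph

/-! ### Principal bundles -/

section PrincipalBundle

open scoped Topology

variable {m k n : ℕ} {M : Type uM} {P : Type uP} {G : Type uG}
  [TopologicalSpace M] [ChartedSpace (EuclideanSpace ℝ (Fin m)) M]
  [TopologicalSpace P] [ChartedSpace (EuclideanSpace ℝ (Fin n)) P]
  [TopologicalSpace G] [ChartedSpace (EuclideanSpace ℝ (Fin k)) G] [Group G]
  [MulAction Gᵐᵒᵖ P] {π : P → M}

namespace IsPrincipalBundle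

theorem continuousSMul (h : IsPrincipalBundle m k n G π) : ContinuousSMul Gᵐᵒᵖ P :=
  ⟨h.contMDiff_action.continuous.comp
    (continuous_snd.prodMk (MulOpposite.continuous_unop.comp continuous_fst))⟩

theorem isCancelSMul (h : IsPrincipalBundle m k n G π) : IsCancelSMul Gᵐᵒᵖ P :=
  isCancelSMul_iff_eq_one_of_smul_eq.2 fun g p hg => MulOpposite.unop_injective (h.free p g.unop hg)

theorem isOpenMap_proj (h : IsPrincipalBundle m k n G π) : IsOpenMap π := by
  refine isOpenMap_iff_nhds_le.2 fun p => ?_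
  obtain ⟨e, he, -⟩ := h.locally_trivial (π p)
  exact (e.map_proj_nhds (e.mem_source.2 he)).ge

theorem isQuotientMap_proj (h : IsPrincipalBundle m k n G π) : Topology.IsQuotientMap π :=
  h.isOpenMap_proj.isQuotientMap h.contMDiff_proj.continuous h.surjective_proj

theorem range_orbitMap (h : IsPrincipalBundle m k n G π) (p : P) :
    Set.range (h.orbitMap p) = π ⁻¹' {π p} := by
  refine subset_antisymm (Set.range_subset_iff.2 fun g => h.proj_smul p g) fun q hq => ?_
  exact h.transitive p q (Set.mem_singleton_iff.1 hq).symm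

theorem connectedSpace [ConnectedSpace M] [ConnectedSpace G]
    (h : IsPrincipalBundle m k n G π) : ConnectedSpace P := by
  have hfibre (x : M) : IsConnected (π ⁻¹' {x}) := by
    obtain ⟨p, rfl⟩ := h.surjective_proj x
    exact h.range_orbitMap p ▸ isConnected_range (h.orbitMap p).continuous
  have huniv := h.isQuotientMap_proj.isCoinducing.isConnected_preimage_of_isClosed hfibre
    isClosed_univ isConnected_univ
  exact connectedSpace_iff_univ.2 (by rwa [Set.preimage_univ] at huniv)

theorem secondCountableTopology [SecondCountableTopology M] [SecondCountableTopology G]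
    (h : IsPrincipalBundle m k n G π) : SecondCountableTopology P := by
  choose e he _ using h.locally_trivial
  obtain ⟨s, hs, hcover⟩ := TopologicalSpace.countable_cover_nhds
    fun x => (e x).open_baseSet.mem_nhds (he x)
  have := hs.to_subtype
  have (x : s) : SecondCountableTopology (e x).source :=
    (e x).toOpenPartialHomeomorph.secondCountableTopology_source
  refine TopologicalSpace.secondCountableTopology_of_countable_cover
    (U := fun x : s => (e x).source) (fun x => (e x).open_source)
    (Set.eq_univ_of_forall fun p => ?_)
  obtain ⟨x, hx, hpx⟩ := Set.mem_iUnion₂.1 (hcover ▸ Set.mem_univ (π p))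
  exact Set.mem_iUnion.2 ⟨⟨x, hx⟩, (e x).mem_source.2 hpx⟩

theorem projStar_orbitMapStar (h : IsPrincipalBundle m k n G π) (p₀ : P)
    (x : FundamentalGroup G (1 : G)) : h.projStar p₀ (h.orbitMapStar p₀ x) = 1 :=
  (mapOfEq_mapOfEq _ _ _ _ x).trans
    (mapOfEq_eq_one (fun g => h.proj_smul p₀ g) x)

theorem exists_section (h : IsPrincipalBundle m k n G π) (p : P) :
    ∃ (V : Set M) (s : M → P), IsOpen V ∧ π p ∈ V ∧ s (π p) = p ∧
      ContMDiffOn (𝓡 m) (𝓡 n) ∞ s V ∧ ∀ y ∈ V, π (s y) = y := by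
  obtain ⟨e, he, -, he', -⟩ := h.locally_trivial (π p)
  refine ⟨e.baseSet, fun y => e.toOpenPartialHomeomorph.symm (y, (e p).2), e.open_baseSet, he,
    e.symm_apply_mk_proj (e.mem_source.2 he), ?_, fun y hy => e.proj_symm_apply' hy⟩
  exact he'.comp (contMDiffOn_id.prodMk contMDiffOn_const) fun y hy => e.mem_target.2 hy

theorem contMDiffOn_smul_section (h : IsPrincipalBundle m k n G π) {V : Set M} {s : M → P}
    (hs : ContMDiffOn (𝓡 m) (𝓡 n) ∞ s V) :
    ContMDiffOn ((𝓡 m).prod (𝓡 k)) (𝓡 n) ∞ (fun z : M × G => s z.1 <• z.2) (V ×ˢ Set.univ) :=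
  h.contMDiff_action.comp_contMDiffOn
    ((hs.comp contMDiffOn_fst fun _ hz => hz.1).prodMk contMDiffOn_snd)

theorem isLocalDiffeomorphAt_smul_section [LieGroup (𝓡 k) ∞ G]
    (h : IsPrincipalBundle m k n G π) {V : Set M} (hV : IsOpen V) {s : M → P}
    (hs : ContMDiffOn (𝓡 m) (𝓡 n) ∞ s V) (hπs : ∀ y ∈ V, π (s y) = y) {z : M × G} (hz : z.1 ∈ V) :
    IsLocalDiffeomorphAt ((𝓡 m).prod (𝓡 k)) (𝓡 n) ∞ (fun z : M × G => s z.1 <• z.2) z := by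
  obtain ⟨e, he, hes, -, heq⟩ := h.locally_trivial z.1
  have hW : IsOpen (V ∩ e.baseSet) := hV.inter e.open_baseSet
  have hsrc : ∀ y ∈ V ∩ e.baseSet, s y ∈ e.source := fun y hy => by
    rw [e.mem_source, hπs y hy.1]
    exact hy.2
  have hproj (y) (hy : y ∈ V ∩ e.baseSet) (g : G) : π (s y <• g) = y := by
    rw [h.proj_smul, hπs y hy.1]
  have hd : ContMDiffOn (𝓡 n) (𝓡 k) ∞ (fun p => (e (s (π p))).2⁻¹ * (e p).2)
      (π ⁻¹' (V ∩ e.baseSet)) := by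
    refine ContMDiffOn.mul (ContMDiffOn.inv ?_) ?_
    · exact contMDiff_snd.comp_contMDiffOn
        (hes.comp (hs.comp h.contMDiff_proj.contMDiffOn fun p hp => hp.1) fun p hp => hsrc _ hp)
    · exact contMDiff_snd.comp_contMDiffOn (hes.mono fun p hp => e.mem_source.2 hp.2)
  refine isLocalDiffeomorphAt_of_contMDiffOn
    (g := fun p => (π p, (e (s (π p))).2⁻¹ * (e p).2)) (A := (V ∩ e.baseSet) ×ˢ Set.univ)
    (B := π ⁻¹' (V ∩ e.baseSet)) (hW.prod isOpen_univ) (hW.preimage h.contMDiff_proj.continuous)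
    ⟨⟨hz, he⟩, trivial⟩ ?_ (h.contMDiffOn_smul_section (hs.mono Set.inter_subset_left))
    (h.contMDiff_proj.contMDiffOn.prodMk hd) ?_ ?_
  · rw [Set.mem_preimage, hproj z.1 ⟨hz, he⟩]
    exact ⟨hz, he⟩
  · rintro ⟨y, g⟩ ⟨hy, -⟩ -
    simp only [hproj y hy, heq _ (hsrc y hy), inv_mul_cancel_left]
  · rintro p hp -
    have hsp : s (π p) <• ((e (s (π p))).2⁻¹ * (e p).2) ∈ e.source := by
      rw [e.mem_source, hproj _ hp]
      exact hp.2
    refine e.injOn hsp (e.mem_source.2 hp.2) (Prod.ext ?_ ?_)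
    · exact (e.coe_fst hsp).trans ((hproj _ hp _).trans (e.coe_fst' hp.2).symm)
    · exact (heq _ (hsrc _ hp) _).trans (mul_inv_cancel_left _ _)

end IsPrincipalBundle

end PrincipalBundle

section EquivariantMap

theorem surjective_of_equivariant {M P Q G G' : Type*} [Group G] [Group G'] [MulAction Gᵐᵒᵖ P]
    [MulAction G'ᵐᵒᵖ Q] {π : P → M} {π' : Q → M} {ρ : G' →* G} {u : Q → P}
    (htrans : ∀ p p' : P, π p = π p' → ∃ g : G, p <• g = p') (hπ' : Function.Surjective π')
    (hρ : Function.Surjective ρ) (hsmul : ∀ (q : Q) (g : G'), u (q <• g) = u q <• ρ g)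
    (hproj : ∀ q, π (u q) = π' q) : Function.Surjective u := by
  intro p
  obtain ⟨q, hq⟩ := hπ' (π p)
  obtain ⟨g, hg⟩ := htrans (u q) p ((hproj q).trans hq)
  obtain ⟨g', rfl⟩ := hρ g
  exact ⟨q <• g', (hsmul q g').trans hg⟩

variable {m k n : ℕ} {M : Type uM} {P : Type uP} {Q : Type*} {G : Type uG} {G' : Type uH}
  [TopologicalSpace M] [ChartedSpace (EuclideanSpace ℝ (Fin m)) M]
  [TopologicalSpace P] [ChartedSpace (EuclideanSpace ℝ (Fin n)) P]
  [TopologicalSpace Q] [ChartedSpace (EuclideanSpace ℝ (Fin n)) Q]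
  [TopologicalSpace G] [ChartedSpace (EuclideanSpace ℝ (Fin k)) G] [Group G]
  [TopologicalSpace G'] [ChartedSpace (EuclideanSpace ℝ (Fin k)) G'] [Group G']
  [MulAction Gᵐᵒᵖ P] [MulAction G'ᵐᵒᵖ Q] {π : P → M} {π' : Q → M} {ρ : G' →* G} {u : Q → P}

namespace IsPrincipalBundle

theorem isLocalDiffeomorph_of_equivariant [LieGroup (𝓡 k) ∞ G] [LieGroup (𝓡 k) ∞ G']
    (h : IsPrincipalBundle m k n G π) (h' : IsPrincipalBundle m k n G' π')
    (hρ : IsLocalDiffeomorph (𝓡 k) (𝓡 k) ∞ ρ) (hu : ContMDiff (𝓡 n) (𝓡 n) ∞ u)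
    (hsmul : ∀ (q : Q) (g : G'), u (q <• g) = u q <• ρ g) (hproj : ∀ q, π (u q) = π' q) :
    IsLocalDiffeomorph (𝓡 n) (𝓡 n) ∞ u := by
  intro q
  obtain ⟨V, s, hV, hqV, hsq, hs, hπs⟩ := h'.exists_section q
  let ψ : M × G' → Q := fun z => s z.1 <• z.2
  have hψ : IsLocalDiffeomorphAt ((𝓡 m).prod (𝓡 k)) (𝓡 n) ∞ ψ (π' q, 1) :=
    h'.isLocalDiffeomorphAt_smul_section hV hs hπs hqV
  have huψ : IsLocalDiffeomorphAt ((𝓡 m).prod (𝓡 k)) (𝓡 n) ∞ (u ∘ ψ) (π' q, 1) := by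
    have huψ_eq : u ∘ ψ = (fun z : M × G => u (s z.1) <• z.2) ∘ Prod.map id ρ :=
      funext fun z => hsmul _ _
    rw [huψ_eq]
    exact (isLocalDiffeomorphAt_prodMap_id (hρ 1)).comp _ _ <|
      h.isLocalDiffeomorphAt_smul_section hV (hu.comp_contMDiffOn hs)
        (fun y hy => (hproj _).trans (hπs y hy)) hqV
  have hψq : ψ (π' q, 1) = q := (one_smul _ _).trans hsq
  exact hψq ▸ isLocalDiffeomorphAt_of_comp_right hψ huψ

theorem eq_iff_exists_smul_of_equivariant (h : IsPrincipalBundle m k n G π)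
    (h' : IsPrincipalBundle m k n G' π')
    (hsmul : ∀ (q : Q) (g : G'), u (q <• g) = u q <• ρ g) (hproj : ∀ q, π (u q) = π' q)
    {q q' : Q} : u q = u q' ↔ ∃ z : G', ρ z = 1 ∧ q <• z = q' := by
  constructor
  · intro hqq'
    obtain ⟨z, hz⟩ := h'.transitive q q' (by rw [← hproj, ← hproj, hqq'])
    exact ⟨z, h.free (u q) _ (by rw [← hsmul, hz, hqq']), hz⟩
  · rintro ⟨z, hz, rfl⟩
    rw [hsmul, hz]
    exact (one_smul _ _).symm

theorem isCoveringMap_of_equivariant [LieGroup (𝓡 k) ∞ G] [LieGroup (𝓡 k) ∞ G']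
    (h : IsPrincipalBundle m k n G π) (h' : IsPrincipalBundle m k n G' π')
    (hρ : IsLocalDiffeomorph (𝓡 k) (𝓡 k) ∞ ρ) (hρs : Function.Surjective ρ)
    (hu : ContMDiff (𝓡 n) (𝓡 n) ∞ u)
    (hsmul : ∀ (q : Q) (g : G'), u (q <• g) = u q <• ρ g) (hproj : ∀ q, π (u q) = π' q) :
    IsCoveringMap u := by
  have := h'.continuousSMul
  have := h'.isCancelSMul
  have : ContinuousConstSMul ρ.ker.op Q := ⟨fun z => continuous_const_smul (z : G'ᵐᵒᵖ)⟩
  have : IsCancelSMul ρ.ker.op Q :=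
    ⟨fun z w q hzw => Subtype.ext (IsCancelSMul.right_cancel (z : G'ᵐᵒᵖ) w q hzw)⟩
  refine isCoveringMap_of_isLocalHomeomorph_of_orbit (H := ρ.ker.op)
    (h.isLocalDiffeomorph_of_equivariant h' hρ hu hsmul hproj).isLocalHomeomorph
    (surjective_of_equivariant h.transitive h'.surjective_proj hρs hsmul hproj) fun {q q'} => ?_
  rw [eq_comm, h.eq_iff_exists_smul_of_equivariant h' hsmul hproj]
  constructor
  · rintro ⟨z, hz, rfl⟩
    exact ⟨⟨.op z, hz⟩, rfl⟩
  · rintro ⟨z, rfl⟩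
    exact ⟨(z : G'ᵐᵒᵖ).unop, z.2, rfl⟩

end IsPrincipalBundle

end EquivariantMap

section PullbackManifold

open scoped Topology

variable {H : Type*} [TopologicalSpace H] {X E : Type*} [TopologicalSpace X] [TopologicalSpace E]
  [ChartedSpace H X] {p : E → X} (hp : IsLocalHomeomorph p)

/-- The charted space structure on the source of a local homeomorphism whose charts are the charts
of the target composed with local restrictions of the map. -/
@[reducible]
noncomputable def pullbackChartedSpace : ChartedSpace H E where
  atlas := {c | ∃ (φ : OpenPartialHomeomorph E X) (x : X), φ = p ∧ c = φ.trans (chartAt H x)}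
  chartAt e := (hp.localInverseAt e).symm.trans (chartAt H (p e))
  mem_chart_source e := by simp
  chart_mem_atlas e := ⟨_, p e, hp.localInverseAt_symm e, rfl⟩

theorem hasGroupoid_pullbackChartedSpace (Γ : StructureGroupoid H) [ClosedUnderRestriction Γ]
    [HasGroupoid X Γ] :
    letI := pullbackChartedSpace (H := H) hp
    HasGroupoid E Γ := by
  let := pullbackChartedSpace (H := H) hp
  refine ⟨?_⟩
  rintro _ _ ⟨φ, x, hφ, rfl⟩ ⟨φ', x', hφ', rfl⟩
  have hφφ' (y : X) (hy : y ∈ φ.target) : φ' (φ.symm y) = y := by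
    rw [hφ', ← hφ, φ.right_inv hy]
  set t := (φ.trans (chartAt H x)).symm.trans (φ'.trans (chartAt H x'))
  have ht : t.restr t.source = t := t.restr_eq_of_source_subset subset_rfl
  rw [← ht]
  refine Γ.restr_mem_of_eqOn
    (Γ.compatible (chart_mem_atlas H x) (chart_mem_atlas H x')) t.open_source ?_ ?_
  · rintro z ⟨⟨-, hz⟩, -⟩
    exact congrArg (chartAt H x') (hφφ' _ hz).symm
  · rintro z ⟨⟨⟨hz, hzφ⟩, -, hz'⟩, -⟩
    have hz' : φ' (φ.symm ((chartAt H x).symm z)) ∈ (chartAt H x').source := hz'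
    rw [hφφ' _ hzφ] at hz'
    exact ⟨hz, hz'⟩

variable {𝕜 : Type*} [NontriviallyNormedField 𝕜] {V : Type*} [NormedAddCommGroup V]
  [NormedSpace 𝕜 V] (I : ModelWithCorners 𝕜 V H) (r : WithTop ℕ∞)

theorem isLocalDiffeomorphAt_chartAt [IsManifold I r X] (x : X) :
    IsLocalDiffeomorphAt I I r (chartAt H x) x :=
  ⟨{ chartAt H x with
      contMDiffOn_toFun := contMDiffOn_chart
      contMDiffOn_invFun := contMDiffOn_chart_symm }, mem_chart_source H x, fun _ _ => rfl⟩

include hp in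
theorem exists_isLocalDiffeomorph [IsManifold I r X] :
    ∃ _ : ChartedSpace H E, IsManifold I r E ∧ IsLocalDiffeomorph I I r p := by
  let := pullbackChartedSpace (H := H) hp
  have : IsManifold I r E := { hasGroupoid_pullbackChartedSpace hp (contDiffGroupoid r I) with }
  refine ⟨_, this, fun e => isLocalDiffeomorphAt_of_comp_left hp.continuous.continuousAt
    (isLocalDiffeomorphAt_chartAt I r (p e)) ?_⟩
  have hchart : chartAt H (p e) ∘ p = chartAt H e :=
    congrArg (chartAt H (p e) ∘ ·) (hp.localInverseAt_symm e).symm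
  exact hchart ▸ isLocalDiffeomorphAt_chartAt I r e

end PullbackManifold

section CoveringBundle

open scoped Topology

theorem exists_division {M P G : Type*} [Group G] [MulAction Gᵐᵒᵖ P] [IsCancelSMul Gᵐᵒᵖ P]
    {π : P → M} (hsmul : ∀ (p : P) (g : G), π (p <• g) = π p)
    (htrans : ∀ p q : P, π p = π q → ∃ g : G, p <• g = q) {V : Set M} {s : M → P}
    (hπs : ∀ y ∈ V, π (s y) = y) :
    ∃ d : P → G, (∀ p, π p ∈ V → s (π p) <• d p = p) ∧ ∀ y ∈ V, ∀ g, d (s y <• g) = g := by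
  have hdiv (p : P) : ∃ d : G, π p ∈ V → s (π p) <• d = p := by
    by_cases hp : π p ∈ V
    · exact (htrans _ p (hπs _ hp)).imp fun _ hd _ => hd
    · exact ⟨1, fun hp' => absurd hp' hp⟩
  choose d hd using hdiv
  refine ⟨d, hd, fun y hy g => ?_⟩
  have hproj : π (s y <• g) = y := (hsmul _ g).trans (hπs y hy)
  have hcancel := hd (s y <• g) (by rwa [hproj])
  rw [hproj] at hcancel
  exact MulOpposite.op_injective (IsCancelSMul.right_cancel _ _ _ hcancel)

variable {m k n : ℕ} {M : Type uM} {P : Type uP} {E : Type*} {G : Type uG} {G' : Type uH}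
  [TopologicalSpace M] [ChartedSpace (EuclideanSpace ℝ (Fin m)) M]
  [TopologicalSpace P] [ChartedSpace (EuclideanSpace ℝ (Fin n)) P]
  [TopologicalSpace G] [ChartedSpace (EuclideanSpace ℝ (Fin k)) G] [Group G]
  [MulAction Gᵐᵒᵖ P] {π : P → M}

theorem exists_trivialization_of_isLocalDiffeomorphAt_smul_section [IsCancelSMul Gᵐᵒᵖ P]
    (hπ : ContMDiff (𝓡 n) (𝓡 m) ∞ π) (hsmul : ∀ (p : P) (g : G), π (p <• g) = π p)
    (htrans : ∀ p q : P, π p = π q → ∃ g : G, p <• g = q) {V : Set M} (hV : IsOpen V) {s : M → P}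
    (hπs : ∀ y ∈ V, π (s y) = y)
    (hψ : ∀ z : M × G, z.1 ∈ V →
      IsLocalDiffeomorphAt ((𝓡 m).prod (𝓡 k)) (𝓡 n) ∞ (fun z : M × G => s z.1 <• z.2) z) :
    ∃ e : Bundle.Trivialization G π, e.baseSet = V ∧
      ContMDiffOn (𝓡 n) ((𝓡 m).prod (𝓡 k)) ∞ e e.source ∧
      ContMDiffOn ((𝓡 m).prod (𝓡 k)) (𝓡 n) ∞ e.toOpenPartialHomeomorph.symm e.target ∧
      ∀ p ∈ e.source, ∀ g : G, (e (p <• g)).2 = (e p).2 * g := by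
  obtain ⟨d, hd, hdψ⟩ := exists_division hsmul htrans hπs
  have hproj (y) (hy : y ∈ V) (g : G) : π (s y <• g) = y := (hsmul _ g).trans (hπs y hy)
  have hτ : ContMDiffOn (𝓡 n) ((𝓡 m).prod (𝓡 k)) ∞ (fun p => (π p, d p)) (π ⁻¹' V) := by
    intro p hp
    have hVd : V ×ˢ Set.univ ∈ 𝓝 (π p, d p) := (hV.prod isOpen_univ).mem_nhds ⟨hp, trivial⟩
    have h := contMDiffAt_of_eventually_leftInverse (g := fun p => (π p, d p)) (hψ (π p, d p) hp) <|
      Filter.mem_of_superset hVd fun z hz => Prod.ext (hproj z.1 hz.1 z.2) (hdψ z.1 hz.1 z.2)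
    exact (hd p hp ▸ h).contMDiffWithinAt
  have hσ : ContMDiffOn ((𝓡 m).prod (𝓡 k)) (𝓡 n) ∞ (fun z : M × G => s z.1 <• z.2)
      (V ×ˢ Set.univ) := fun z hz => (hψ z hz.1).contMDiffAt.contMDiffWithinAt
  let e : Bundle.Trivialization G π :=
    { toFun := fun p => (π p, d p)
      invFun := fun z => s z.1 <• z.2
      source := π ⁻¹' V
      target := V ×ˢ Set.univ
      baseSet := V
      map_source' := fun p hp => ⟨hp, trivial⟩
      map_target' := fun z hz => by rw [Set.mem_preimage, hproj z.1 hz.1]; exact hz.1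
      left_inv' := fun p hp => hd p hp
      right_inv' := fun z hz => Prod.ext (hproj z.1 hz.1 z.2) (hdψ z.1 hz.1 z.2)
      open_source := hV.preimage hπ.continuous
      open_target := hV.prod isOpen_univ
      open_baseSet := hV
      continuousOn_toFun := hτ.continuousOn
      continuousOn_invFun := hσ.continuousOn
      source_eq := rfl
      target_eq := rfl
      proj_toFun := fun _ _ => rfl }
  refine ⟨e, rfl, hτ, hσ, fun p hp g => ?_⟩
  have hpg : p <• g = s (π p) <• (d p * g) := by
    rw [MulOpposite.op_mul, mul_smul, hd p hp]
  exact (congrArg d hpg).trans (hdψ _ hp _)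

variable [TopologicalSpace G'] [ChartedSpace (EuclideanSpace ℝ (Fin k)) G'] [Group G']
  {ρ : G' →* G} [TopologicalSpace E] [ChartedSpace (EuclideanSpace ℝ (Fin n)) E] {p : E → P}

namespace IsPrincipalBundle

theorem exists_section_lift (h : IsPrincipalBundle m k n G π)
    (hp : IsLocalDiffeomorph (𝓡 n) (𝓡 n) ∞ p) (hps : Function.Surjective p) (x : M) :
    ∃ (V : Set M) (s : M → E), IsOpen V ∧ x ∈ V ∧
      ContMDiffOn (𝓡 m) (𝓡 n) ∞ s V ∧ ∀ y ∈ V, π (p (s y)) = y := by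
  obtain ⟨e, rfl⟩ := h.surjective_proj.comp hps x
  obtain ⟨V, s, hV, heV, hse, hs, hπs⟩ := h.exists_section (p e)
  let r := (hp e).localInverse
  refine ⟨V ∩ s ⁻¹' r.source, r ∘ s, hs.continuousOn.isOpen_inter_preimage hV r.open_source,
    ⟨heV, ?_⟩, ?_, ?_⟩
  · exact Set.mem_preimage.2 (hse.symm ▸ (hp e).localInverse_mem_source)
  · exact (hp e).localInverse_contMDiffOn.comp (hs.mono Set.inter_subset_left) fun y hy => hy.2
  · rintro y ⟨hy, hys⟩
    exact (congrArg π ((hp e).localInverse_right_inv hys)).trans (hπs y hy)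

variable [MulAction G'ᵐᵒᵖ E]

theorem isLocalDiffeomorphAt_smul_section_lift [LieGroup (𝓡 k) ∞ G] [ContinuousSMul G'ᵐᵒᵖ E]
    (h : IsPrincipalBundle m k n G π) (hρ : IsLocalDiffeomorph (𝓡 k) (𝓡 k) ∞ ρ)
    (hp : IsLocalDiffeomorph (𝓡 n) (𝓡 n) ∞ p)
    (hsmul : ∀ (e : E) (g : G'), p (e <• g) = p e <• ρ g) {V : Set M} (hV : IsOpen V) {s : M → E}
    (hs : ContMDiffOn (𝓡 m) (𝓡 n) ∞ s V) (hπs : ∀ y ∈ V, π (p (s y)) = y) {z : M × G'}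
    (hz : z.1 ∈ V) :
    IsLocalDiffeomorphAt ((𝓡 m).prod (𝓡 k)) (𝓡 n) ∞ (fun z : M × G' => s z.1 <• z.2) z := by
  have hsz : ContinuousAt (fun z : M × G' => s z.1) z :=
    (hs.continuousOn.continuousAt (hV.mem_nhds hz)).comp continuousAt_fst
  refine isLocalDiffeomorphAt_of_comp_left
    ((MulOpposite.continuous_op.continuousAt.comp continuousAt_snd).smul hsz) (hp _) ?_
  have hpψ : (p ∘ fun z : M × G' => s z.1 <• z.2) =
      (fun z : M × G => p (s z.1) <• z.2) ∘ Prod.map id ρ := funext fun z => hsmul _ _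
  rw [hpψ]
  exact (isLocalDiffeomorphAt_prodMap_id (hρ z.2)).comp _ _ <|
    h.isLocalDiffeomorphAt_smul_section hV (hp.contMDiff.comp_contMDiffOn hs) hπs hz

theorem isPrincipalBundle_lift [LieGroup (𝓡 k) ∞ G] [ContinuousSMul G'ᵐᵒᵖ E]
    (h : IsPrincipalBundle m k n G π)
    (hρ : IsLocalDiffeomorph (𝓡 k) (𝓡 k) ∞ ρ) (hρs : Function.Surjective ρ)
    (hp : IsLocalDiffeomorph (𝓡 n) (𝓡 n) ∞ p) (hps : Function.Surjective p)
    (hsmul : ∀ (e : E) (g : G'), p (e <• g) = p e <• ρ g)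
    (hfree : ∀ (e : E) (g : G'), ρ g = 1 → e <• g = e → g = 1)
    (htrans : ∀ e e' : E, p e = p e' → ∃ z : G', ρ z = 1 ∧ e <• z = e') :
    IsPrincipalBundle m k n G' (π ∘ p) := by
  have hcont : Continuous fun x : E × G' => x.1 <• x.2 := by fun_prop
  have hproj (e : E) (g : G') : π (p (e <• g)) = π (p e) := by rw [hsmul, h.proj_smul]
  have hfree' (e : E) (g : G') (hg : e <• g = e) : g = 1 :=
    hfree e g (h.free (p e) _ (by rw [← hsmul, hg])) hg
  have htrans' (e e' : E) (hee' : π (p e) = π (p e')) : ∃ g : G', e <• g = e' := by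
    obtain ⟨g, hg⟩ := h.transitive _ _ hee'
    obtain ⟨g', rfl⟩ := hρs g
    obtain ⟨z, -, hz⟩ := htrans (e <• g') e' ((hsmul e g').trans hg)
    exact ⟨g' * z, by rw [MulOpposite.op_mul, mul_smul, hz]⟩
  have : IsCancelSMul G'ᵐᵒᵖ E := isCancelSMul_iff_eq_one_of_smul_eq.2
    fun g e hg => MulOpposite.unop_injective (hfree' e g.unop hg)
  have hπp := h.contMDiff_proj.comp hp.contMDiff
  refine
    { contMDiff_proj := hπp
      surjective_proj := h.surjective_proj.comp hps
      contMDiff_action := contMDiff_of_comp hp hcont ?_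
      proj_smul := hproj
      transitive := htrans'
      free := hfree'
      locally_trivial := fun x => ?_ }
  · refine (h.contMDiff_action.comp
      ((hp.contMDiff.comp contMDiff_fst).prodMk (hρ.contMDiff.comp contMDiff_snd))).congr ?_
    exact fun x => hsmul x.1 x.2
  · obtain ⟨V, s, hV, hxV, hs, hπs⟩ := h.exists_section_lift hp hps x
    obtain ⟨e, rfl, he⟩ := exists_trivialization_of_isLocalDiffeomorphAt_smul_section (k := k)
      hπp hproj htrans' hV hπs
      fun _ => h.isLocalDiffeomorphAt_smul_section_lift hρ hp hsmul hV hs hπs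
    exact ⟨e, hxV, he⟩

end IsPrincipalBundle

end CoveringBundle

/-! ### Spinor structures -/

theorem pathConnectedSpace_of_chartedSpace (H : Type*) {X : Type*} [TopologicalSpace H]
    [LocallyPathConnectedSpace H] [TopologicalSpace X] [ChartedSpace H X] [ConnectedSpace X] :
    PathConnectedSpace X :=
  have := ChartedSpace.locallyPathConnectedSpace H X
  pathConnectedSpace_iff_connectedSpace.2 inferInstance

theorem IsUniversalCoveringGroup.surjective {k : ℕ} {G : Type uG} {G' : Type uH}
    [TopologicalSpace G] [ChartedSpace (EuclideanSpace ℝ (Fin k)) G] [Group G] [ConnectedSpace G]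
    [TopologicalSpace G'] [ChartedSpace (EuclideanSpace ℝ (Fin k)) G'] [Group G'] {ρ : G' →* G}
    (hρ : IsUniversalCoveringGroup k ρ) : Function.Surjective ρ :=
  have := pathConnectedSpace_of_chartedSpace (EuclideanSpace ℝ (Fin k)) (X := G)
  surjective_of_isCoveringMap hρ.isCoveringMap

namespace IsPrincipalBundle

variable {m k n : ℕ} {M : Type uM} {P : Type uP} {G : Type uG}
  [TopologicalSpace M] [ChartedSpace (EuclideanSpace ℝ (Fin m)) M]
  [TopologicalSpace P] [ChartedSpace (EuclideanSpace ℝ (Fin n)) P]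
  [TopologicalSpace G] [ChartedSpace (EuclideanSpace ℝ (Fin k)) G] [Group G]
  [MulAction Gᵐᵒᵖ P] {π : P → M} (h : IsPrincipalBundle m k n G π) {p₀ : P}

theorem commute_orbitMapStar (γ : FundamentalGroup P p₀) (g : FundamentalGroup G (1 : G)) :
    Commute γ (h.orbitMapStar p₀ g) :=
  have := h.continuousSMul
  commute_rightOrbitStar γ g

variable {h} (hex : h.ExistenceCondition p₀) {K₀ K : Subgroup (FundamentalGroup P p₀)}

include hex

theorem ker_projStar : (h.projStar p₀).ker = (h.orbitMapStar p₀).range := by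
  obtain ⟨-, K, hK⟩ := hex
  exact ker_eq_range_of_sup_eq_top h.commute_orbitMapStar (h.projStar_orbitMapStar p₀)
    hK.bijOn_projStar.injOn hK.sup_eq_top

theorem projStar_surjective : Function.Surjective (h.projStar p₀) := by
  obtain ⟨-, K, hK⟩ := hex
  exact Set.surjOn_univ.1 (hK.bijOn_projStar.surjOn.mono (Set.subset_univ _) subset_rfl)

theorem bijOn_projStar_iff_isCompl :
    Set.BijOn (h.projStar p₀) K Set.univ ↔ IsCompl K (h.orbitMapStar p₀).range := by
  rw [bijOn_univ_iff_isCompl_ker (projStar_surjective hex), ker_projStar hex]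

theorem isComplement_iff_bijOn : h.IsComplement p₀ K ↔ Set.BijOn (h.projStar p₀) K Set.univ := by
  refine ⟨IsComplement.bijOn_projStar, fun hK => ?_⟩
  have hcompl := (bijOn_projStar_iff_isCompl hex).1 hK
  refine ⟨?_, hcompl.inf_eq_bot, hcompl.sup_eq_top, hK⟩
  rintro γ - _ ⟨g, rfl⟩
  exact h.commute_orbitMapStar γ g

omit hex in
theorem IsComplement.eq_of_le (hK₀ : h.IsComplement p₀ K₀) (hK : h.IsComplement p₀ K)
    (hle : K₀ ≤ K) : K₀ = K := by
  obtain ⟨s, hs, rfl⟩ := exists_leftInverse_range_eq hK₀.bijOn_projStar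
  obtain ⟨t, ht, rfl⟩ := exists_leftInverse_range_eq hK.bijOn_projStar
  rw [eq_of_range_le_of_leftInverse hs ht hle]

/-- The parametrisation of the complements by the homomorphisms `π₁(M) → π₁(G)`, relative to a fixed
complement `K₀`, which is encoded as a section of `π_*`. -/
noncomputable def homEquivComplement (hK₀ : h.IsComplement p₀ K₀) :
    (FundamentalGroup M (π p₀) →* FundamentalGroup G (1 : G)) ≃
      {K : Subgroup (FundamentalGroup P p₀) // h.IsComplement p₀ K} :=
  have hs := (exists_leftInverse_range_eq hK₀.bijOn_projStar).choose_spec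
  (homEquivBijOn hs.1 h.commute_orbitMapStar hex.1 (ker_projStar hex)).trans
    (Equiv.subtypeEquivRight fun _ => (isComplement_iff_bijOn hex).symm)

theorem mem_homEquivComplement (hK₀ : h.IsComplement p₀ K₀)
    (φ : FundamentalGroup M (π p₀) →* FundamentalGroup G (1 : G)) (x : FundamentalGroup P p₀) :
    x ∈ (homEquivComplement hex hK₀ φ : Subgroup (FundamentalGroup P p₀)) ↔
      ∃ y ∈ K₀, x = y * h.orbitMapStar p₀ (φ (h.projStar p₀ y)) := by
  have hs := (exists_leftInverse_range_eq hK₀.bijOn_projStar).choose_spec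
  refine (mem_range_centralTwist hs.1 h.commute_orbitMapStar φ).trans ?_
  rw [hs.2]

theorem homEquivComplement_one (hK₀ : h.IsComplement p₀ K₀) :
    homEquivComplement hex hK₀ 1 = ⟨K₀, hK₀⟩ := by
  ext x
  simp only [mem_homEquivComplement, MonoidHom.one_apply, map_one, mul_one, exists_eq_right']

end IsPrincipalBundle

namespace SpinorStructure

open FundamentalGroup

variable {m k n : ℕ} {M : Type uM} {P : Type uP} {G : Type uG} {G' : Type uH}
  [TopologicalSpace M] [ChartedSpace (EuclideanSpace ℝ (Fin m)) M]
  [TopologicalSpace P] [ChartedSpace (EuclideanSpace ℝ (Fin n)) P]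
  [Group G] [MulAction Gᵐᵒᵖ P]
  [TopologicalSpace G'] [ChartedSpace (EuclideanSpace ℝ (Fin k)) G'] [Group G']
  {ρ : G' →* G} {π : P → M}

theorem Equivalent.refl (S : SpinorStructure m k n ρ π) : S.Equivalent S :=
  ⟨id, contMDiff_id, fun _ _ => rfl, fun _ => rfl, fun _ => rfl⟩

theorem Equivalent.trans {S T U : SpinorStructure m k n ρ π} (hST : S.Equivalent T)
    (hTU : T.Equivalent U) : S.Equivalent U := by
  obtain ⟨a, ha, hsmul, hproj, hmap⟩ := hST
  obtain ⟨b, hb, hsmul', hproj', hmap'⟩ := hTU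
  refine ⟨b ∘ a, hb.comp ha, fun q g => ?_, fun q => ?_, fun q => ?_⟩
  · simp only [Function.comp_apply, hsmul, hsmul']
  · exact (hproj' _).trans (hproj q)
  · exact (hmap' _).trans (hmap q)

theorem imageSubgroup_le_of_comp {S T : SpinorStructure m k n ρ π} {p₀ : P} {q₀ : S.Q}
    (hq₀ : S.spinorMap q₀ = p₀) {a : S.Q → T.Q} (ha : Continuous a)
    (hTa : ∀ q, T.spinorMap (a q) = S.spinorMap q) :
    S.imageSubgroup q₀ hq₀ ≤ T.imageSubgroup (a q₀) ((hTa q₀).trans hq₀) := by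
  rintro _ ⟨γ, rfl⟩
  refine ⟨mapOfEq ⟨a, ha⟩ rfl γ, (mapOfEq_mapOfEq ..).trans ?_⟩
  congr 2
  exact ContinuousMap.ext hTa

variable [TopologicalSpace G] [ChartedSpace (EuclideanSpace ℝ (Fin k)) G]
  {S T : SpinorStructure m k n ρ π} (hρ : IsUniversalCoveringGroup k ρ)
  (hπ : IsPrincipalBundle m k n G π) {p₀ : P}

include hπ

theorem imageSubgroup_eq {q₀ q₁ : S.Q} (hq₀ : S.spinorMap q₀ = p₀) (hq₁ : S.spinorMap q₁ = p₀) :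
    S.imageSubgroup q₀ hq₀ = S.imageSubgroup q₁ hq₁ := by
  have := S.isPrincipalBundle.continuousSMul
  have hle {q₀ q₁ : S.Q} (hq₀ : S.spinorMap q₀ = p₀) (hq₁ : S.spinorMap q₁ = p₀) :
      S.imageSubgroup q₀ hq₀ ≤ S.imageSubgroup q₁ hq₁ := by
    obtain ⟨z, hz, rfl⟩ := (hπ.eq_iff_exists_smul_of_equivariant S.isPrincipalBundle
      S.spinorMap_smul S.proj_spinorMap).1 (hq₀.trans hq₁.symm)
    exact imageSubgroup_le_of_comp hq₀ (continuous_const_smul (MulOpposite.op z))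
      fun q => by simp [S.spinorMap_smul, hz]
  exact le_antisymm (hle hq₀ hq₁) (hle hq₁ hq₀)

include hρ

variable (S) in
theorem spinorMap_surjective [ConnectedSpace G] : Function.Surjective S.spinorMap :=
  surjective_of_equivariant hπ.transitive S.isPrincipalBundle.surjective_proj hρ.surjective
    S.spinorMap_smul S.proj_spinorMap

variable [LieGroup (𝓡 k) ∞ G] [LieGroup (𝓡 k) ∞ G']

theorem isLocalDiffeomorph_spinorMap : IsLocalDiffeomorph (𝓡 n) (𝓡 n) ∞ S.spinorMap :=
  hπ.isLocalDiffeomorph_of_equivariant S.isPrincipalBundle hρ.isLocalDiffeomorph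
    S.contMDiff_spinorMap S.spinorMap_smul S.proj_spinorMap

variable [ConnectedSpace G]

theorem isCoveringMap_spinorMap : IsCoveringMap S.spinorMap :=
  hπ.isCoveringMap_of_equivariant S.isPrincipalBundle hρ.isLocalDiffeomorph hρ.surjective
    S.contMDiff_spinorMap S.spinorMap_smul S.proj_spinorMap

theorem isComplement_imageSubgroup (hex : hπ.ExistenceCondition p₀) {q₀ : S.Q}
    (hq₀ : S.spinorMap q₀ = p₀) : hπ.IsComplement p₀ (S.imageSubgroup q₀ hq₀) := by
  have := hρ.simplyConnected
  have := hπ.continuousSMul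
  have := S.isPrincipalBundle.continuousSMul
  have hS : IsCoveringMap S.spinorMap := isCoveringMap_spinorMap hρ hπ
  have inf_eq_bot := range_inf_range_rightOrbitStar hS hρ.isCoveringMap S.spinorMap_smul hq₀
    (S.isPrincipalBundle.free q₀)
  have sup_eq_top := range_sup_range_rightOrbitStar hS hρ.isCoveringMap S.spinorMap_smul hq₀
    fun q hq => (hπ.eq_iff_exists_smul_of_equivariant S.isPrincipalBundle S.spinorMap_smul
      S.proj_spinorMap).1 (hq₀.trans hq.symm)
  exact (IsPrincipalBundle.isComplement_iff_bijOn hex).2 <|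
    (IsPrincipalBundle.bijOn_projStar_iff_isCompl hex).2
      ⟨disjoint_iff.2 inf_eq_bot, codisjoint_iff.2 sup_eq_top⟩

theorem Equivalent.imageSubgroup_eq (hST : S.Equivalent T) (hex : hπ.ExistenceCondition p₀)
    {q₀ : S.Q} {q₁ : T.Q} (hq₀ : S.spinorMap q₀ = p₀) (hq₁ : T.spinorMap q₁ = p₀) :
    S.imageSubgroup q₀ hq₀ = T.imageSubgroup q₁ hq₁ := by
  obtain ⟨a, ha, -, -, hTa⟩ := hST
  rw [SpinorStructure.imageSubgroup_eq hπ hq₁ ((hTa q₀).trans hq₀)]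
  exact (isComplement_imageSubgroup hρ hπ hex hq₀).eq_of_le
    (isComplement_imageSubgroup hρ hπ hex _) (imageSubgroup_le_of_comp hq₀ ha.continuous hTa)

variable [ConnectedSpace M]

theorem exists_lift_spinorMap {q₀ : S.Q} {q₁ : T.Q} (hq₀ : S.spinorMap q₀ = p₀)
    (hq₁ : T.spinorMap q₁ = p₀) (hST : S.imageSubgroup q₀ hq₀ ≤ T.imageSubgroup q₁ hq₁) :
    ∃ a : C(S.Q, T.Q), a q₀ = q₁ ∧ ∀ q, T.spinorMap (a q) = S.spinorMap q := by
  have := hρ.simplyConnected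
  have := S.isPrincipalBundle.connectedSpace
  have := ChartedSpace.locallyPathConnectedSpace (EuclideanSpace ℝ (Fin n)) S.Q
  have := pathConnectedSpace_of_chartedSpace (EuclideanSpace ℝ (Fin n)) (X := S.Q)
  subst hq₀
  let u : C(S.Q, P) := ⟨S.spinorMap, S.contMDiff_spinorMap.continuous⟩
  obtain ⟨a, ⟨ha₀, ha⟩, -⟩ := (isCoveringMap_spinorMap (S := T) hρ hπ
    ).existsUnique_continuousMap_lifts_of_range_le (f := u) hq₁ fun _ ⟨γ, hγ⟩ =>
      hST ⟨γ, by rwa [mapOfEq_apply, Path.Homotopic.Quotient.cast_rfl_rfl]⟩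
  exact ⟨a, ha₀, congrFun ha⟩

theorem equivalent_of_imageSubgroup_le {q₀ : S.Q} {q₁ : T.Q} (hq₀ : S.spinorMap q₀ = p₀)
    (hq₁ : T.spinorMap q₁ = p₀) (hST : S.imageSubgroup q₀ hq₀ ≤ T.imageSubgroup q₁ hq₁) :
    S.Equivalent T := by
  have := hρ.simplyConnected
  have := S.isPrincipalBundle.connectedSpace
  have := S.isPrincipalBundle.continuousSMul
  have := T.isPrincipalBundle.continuousSMul
  obtain ⟨a, -, hTa⟩ := exists_lift_spinorMap hρ hπ hq₀ hq₁ hST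
  have ha_smul : (fun x : S.Q × G' => a (x.1 <• x.2)) = fun x => a x.1 <• x.2 :=
    (isCoveringMap_spinorMap hρ hπ).eq_of_comp_eq (by fun_prop) (by fun_prop)
      (funext fun x => by simp [hTa, S.spinorMap_smul, T.spinorMap_smul]) (q₀, 1) (by simp)
  refine ⟨a, ?_, fun q g => congrFun ha_smul (q, g), fun q => ?_, hTa⟩
  · exact contMDiff_of_comp (isLocalDiffeomorph_spinorMap hρ hπ) a.continuous
      (S.contMDiff_spinorMap.congr hTa)
  · rw [← T.proj_spinorMap, hTa, S.proj_spinorMap]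

theorem Equivalent.symm (hST : S.Equivalent T) (hex : hπ.ExistenceCondition p₀) :
    T.Equivalent S := by
  obtain ⟨q₀, hq₀⟩ := S.spinorMap_surjective hρ hπ p₀
  obtain ⟨q₁, hq₁⟩ := T.spinorMap_surjective hρ hπ p₀
  exact equivalent_of_imageSubgroup_le hρ hπ hq₁ hq₀ (hST.imageSubgroup_eq hρ hπ hex hq₀ hq₁).ge

theorem exists_imageSubgroup_eq [SecondCountableTopology M] [T2Space P] [IsManifold (𝓡 n) ∞ P]
    [SecondCountableTopology G'] (hinj : Function.Injective (hπ.orbitMapStar p₀))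
    {K : Subgroup (FundamentalGroup P p₀)} (hK : hπ.IsComplement p₀ K) :
    ∃ (S : SpinorStructure m k n ρ π) (q₀ : S.Q) (hq₀ : S.spinorMap q₀ = p₀),
      S.imageSubgroup q₀ hq₀ = K := by
  have := hρ.simplyConnected
  have := hπ.connectedSpace
  have := hπ.continuousSMul
  have := ChartedSpace.locallyPathConnectedSpace (EuclideanSpace ℝ (Fin n)) P
  have := pathConnectedSpace_of_chartedSpace (EuclideanSpace ℝ (Fin n)) (X := P)
  have := ChartedSpace.locallyPathConnectedSpace (EuclideanSpace ℝ (Fin k)) G'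
  have := continuousMul_of_contMDiffMul (𝓡 k) ∞ (G := G')
  obtain ⟨Q, _, u, hu, q₀, hq₀, _, rfl⟩ := exists_isCoveringMap_range_eq
    (exists_simplyConnected_nhd (V := EuclideanSpace ℝ (Fin n))) K
  obtain ⟨_, _, hu'⟩ := exists_isLocalDiffeomorph hu.isLocalHomeomorph (𝓡 n) ∞
  have := ChartedSpace.locallyPathConnectedSpace (EuclideanSpace ℝ (Fin n)) Q
  obtain ⟨_, _, hsmul⟩ := exists_mulAction_lift hu hρ.isCoveringMap.continuous
  have hbundle := hπ.isPrincipalBundle_lift hρ.isLocalDiffeomorph hρ.surjective hu'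
    (surjective_of_isCoveringMap hu) hsmul
    (fun _ _ => eq_one_of_smul_eq hu hρ.isCoveringMap hsmul hq₀ hinj hK.inf_eq_bot)
    (fun _ _ => exists_smul_eq_of_sup_eq_top hu hρ.isCoveringMap hsmul hq₀ hK.sup_eq_top)
  have := hbundle.secondCountableTopology
  have := t2Space_of_isCoveringMap hu
  exact ⟨{ Q := Q
           proj := π ∘ u
           isPrincipalBundle := hbundle
           spinorMap := u
           contMDiff_spinorMap := hu'.contMDiff
           spinorMap_smul := hsmul
           proj_spinorMap := fun _ => rfl }, q₀, hq₀, rfl⟩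

end SpinorStructure

namespace SpinorClass

open SpinorStructure

variable {m k n : ℕ} {M : Type uM} {P : Type uP} {G : Type uG} {G' : Type uH}
  [TopologicalSpace M] [ChartedSpace (EuclideanSpace ℝ (Fin m)) M]
  [TopologicalSpace P] [ChartedSpace (EuclideanSpace ℝ (Fin n)) P]
  [TopologicalSpace G] [ConnectedSpace G] [ChartedSpace (EuclideanSpace ℝ (Fin k)) G] [Group G]
  [LieGroup (𝓡 k) ∞ G] [MulAction Gᵐᵒᵖ P]
  [TopologicalSpace G'] [ChartedSpace (EuclideanSpace ℝ (Fin k)) G'] [Group G']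
  [LieGroup (𝓡 k) ∞ G'] {ρ : G' →* G} {π : P → M} (hρ : IsUniversalCoveringGroup k ρ)
  {hπ : IsPrincipalBundle m k n G π} {p₀ : P} (hex : hπ.ExistenceCondition p₀)

/-- The complement `u_*(π₁(Q, q₀))` attached to the class of a spinor structure `u : Q → P`, for an
arbitrarily chosen point `q₀` over `p₀`. -/
noncomputable def complement :
    SpinorClass m k n ρ π → {K : Subgroup (FundamentalGroup P p₀) // hπ.IsComplement p₀ K} :=
  Quot.lift (fun S => ⟨S.imageSubgroup _ (S.spinorMap_surjective hρ hπ p₀).choose_spec,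
    isComplement_imageSubgroup hρ hπ hex _⟩)
    fun _ _ hST => Subtype.ext (hST.imageSubgroup_eq hρ hπ hex _ _)

theorem complement_toClass (S : SpinorStructure m k n ρ π) {q₀ : S.Q}
    (hq₀ : S.spinorMap q₀ = p₀) :
    (complement hρ hex S.toClass : Subgroup (FundamentalGroup P p₀)) = S.imageSubgroup q₀ hq₀ :=
  imageSubgroup_eq hπ _ hq₀

theorem complement_bijective [ConnectedSpace M] [SecondCountableTopology M] [T2Space P]
    [IsManifold (𝓡 n) ∞ P] [SecondCountableTopology G'] :
    Function.Bijective (complement (m := m) hρ hex) := by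
  refine ⟨?_, fun ⟨K, hK⟩ => ?_⟩
  · rintro ⟨S⟩ ⟨T⟩ hST
    exact Quot.sound (equivalent_of_imageSubgroup_le hρ hπ _ _ (congrArg Subtype.val hST).le)
  · obtain ⟨S, q₀, hq₀, hS⟩ := exists_imageSubgroup_eq hρ hπ hex.1 hK
    exact ⟨S.toClass, Subtype.ext ((complement_toClass hρ hex S hq₀).trans hS)⟩

end SpinorClass

theorem mainTheorem2 {m k n : ℕ} {M : Type uM} {P : Type uP} {G : Type uG} {G' : Type uH}
    [TopologicalSpace M] [T2Space M] [SecondCountableTopology M] [ConnectedSpace M]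
    [ChartedSpace (EuclideanSpace ℝ (Fin m)) M] [IsManifold (𝓡 m) ∞ M]
    [TopologicalSpace P] [T2Space P] [SecondCountableTopology P]
    [ChartedSpace (EuclideanSpace ℝ (Fin n)) P] [IsManifold (𝓡 n) ∞ P]
    [TopologicalSpace G] [T2Space G] [SecondCountableTopology G] [ConnectedSpace G]
    [ChartedSpace (EuclideanSpace ℝ (Fin k)) G] [Group G] [LieGroup (𝓡 k) ∞ G]
    [TopologicalSpace G'] [T2Space G'] [SecondCountableTopology G']
    [ChartedSpace (EuclideanSpace ℝ (Fin k)) G'] [Group G'] [LieGroup (𝓡 k) ∞ G']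
    (ρ : G' →* G) (hρ : IsUniversalCoveringGroup k ρ)
    [MulAction Gᵐᵒᵖ P] (π : P → M) (hπ : IsPrincipalBundle m k n G π) (p₀ : P)
    (hex : hπ.ExistenceCondition p₀) :
    -- equivalence of spinor structures is an equivalence relation, and
    Equivalence (SpinorStructure.Equivalent (m := m) (k := k) (n := n) (ρ := ρ) (π := π)) ∧
    -- the class of `u : Q → P` is determined by the complement `u_*(π₁(Q))`, which is arbitrary;
    ∃ κ : SpinorClass m k n ρ π ≃ {K : Subgroup (FundamentalGroup P p₀) // hπ.IsComplement p₀ K},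
      (∀ (S : SpinorStructure m k n ρ π) (q₀ : S.Q) (hq₀ : S.spinorMap q₀ = p₀),
        (κ S.toClass : Subgroup (FundamentalGroup P p₀)) = S.imageSubgroup q₀ hq₀) ∧
      -- relative to any fixed `S₀`, the classes correspond to homomorphisms `π₁(M) → π₁(G)`.
      ∀ S₀ : SpinorStructure m k n ρ π,
        ∃ Φ : SpinorClass m k n ρ π ≃ (FundamentalGroup M (π p₀) →* FundamentalGroup G (1 : G)),
          Φ S₀.toClass = 1 ∧
          ∀ (c : SpinorClass m k n ρ π) (x : FundamentalGroup P p₀),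
            x ∈ (κ c : Subgroup (FundamentalGroup P p₀)) ↔
              ∃ y ∈ (κ S₀.toClass : Subgroup (FundamentalGroup P p₀)),
                x = y * hπ.orbitMapStar p₀ (Φ c (hπ.projStar p₀ y)) := by
  refine ⟨⟨fun S => .refl S, fun hST => hST.symm hρ hπ hex, fun hST hTU => hST.trans hTU⟩, ?_⟩
  let κ := Equiv.ofBijective _ (SpinorClass.complement_bijective (m := m) hρ hex)
  refine ⟨κ, fun S q₀ hq₀ => SpinorClass.complement_toClass hρ hex S hq₀, fun S₀ => ?_⟩
  let homEquiv := IsPrincipalBundle.homEquivComplement hex (κ S₀.toClass).2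
  refine ⟨κ.trans homEquiv.symm, ?_, fun c x => ?_⟩
  · rw [Equiv.trans_apply, Equiv.symm_apply_eq, IsPrincipalBundle.homEquivComplement_one]
  · rw [← IsPrincipalBundle.mem_homEquivComplement hex (κ S₀.toClass).2, Equiv.trans_apply,
      Equiv.apply_symm_apply]
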